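/- Let $0<R\le\infty$ and let $\sigma_1,\sigma_2,\sigma_3$ be the right-invariant 1-forms on $SU(2)$ with $d\sigma_i=-\tfrac12\epsilon_{ijk}\,\sigma_j\wedge\sigma_k$ and dual vector fields $L_1,L_2,L_3$. Let $(h,J)$ be a smooth Kähler structure on $(0,R)\times SU(2)$, with Kähler form $\Omega=h(\cdot,J\cdot)$, that is invariant under the right action of $SU(2)$ and whose metric has the form $h=d\rho^2+h_{ij}(\rho)\sigma_i\sigma_j$. Write $h=d\rho^2+\sum_i (e^i)^2$ and $\Omega=d\rho\wedge e^3-e^1\wedge e^2$ with a coframe $e^i=\sum_j E^i{}_j(\rho)\sigma_j$, and assume that it is positively oriented, $\det E(\rho)>0$ for all $\rho\in(0,R)$ (for the triangular frames below, this is implied by $a,b,c>0$). Suppose that at $\rho=0$ one of the following holds. * (Nut) The metric $h$ extends to a smooth Riemannian metric on the ball of radius $R$ in $\mathbb R^4$, where $(\rho,q)\in(0,R)\times SU(2)$ is the point $\rho q$, and $SU(2)$ is the unit sphere $S^3\subset\mathbb R^4$. * (Bolt I, or complex bolt) For some integer $p\ge1$, the metric descends to $(0,R)\times SU(2)/\mathbb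 Z_p$, where $\mathbb Z_p$ is a subgroup of the circle generated by $L_3$, and extends to a smooth Riemannian metric on the $\mathbb R^2$-bundle over $S^2$ that is obtained by collapsing at $\rho=0$ the circles generated by $L_3$; and the zero section (the bolt $S^2$) is complex, i.e. $\Omega(\partial_\rho,L_1)$ and $\Omega(\partial_\rho,L_2)$ tend to $0$ as $\rho\to0$. Then the Kähler structure has $U(1)\times SU(2)$ symmetry: $h$ and $J$ are also invariant under a circle subgroup of the left action of $SU(2)$. Moreover, if the coframe is of the form $$e^1=a\sigma_1+b_1\sigma_2+c_1\sigma_3,\qquad e^2=b\sigma_2+c_2\sigma_3,\qquad e^3=c\sigma_3$$ with $a,b,c>0$ for all $\rho\in(0,R)$ (in particular if $h=d\rho^2+a^2\sigma_1^2+b^2\sigma_2^2+c^2\sigma_3^2$ with $\Omega = c\,d\rho\wedge\sigma_3-ab\,\sigma_1\wedge\sigma_2$), then $a=b$ and $b_1=c_1=c_2=0$ for all $\rho\in(0,R)$. -/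

import Mathlib

open scoped Quaternion ContDiff Topology ENNReal

noncomputable section

namespace SU2Kahler

/-! ### Kähler structures on open subsets of a real vector space -/

section General

variable {V : Type*} [NormedAddCommGroup V] [NormedSpace ℝ V]

/-- A field of bilinear forms (a covariant 2-tensor field). -/
abbrev BilinField (V : Type*) [NormedAddCommGroup V] [NormedSpace ℝ V] : Type _ :=
  V → V →L[ℝ] V →L[ℝ] ℝ

/-- A field of endomorphisms of the tangent spaces. -/
abbrev EndField (V : Type*) [NormedAddCommGroup V] [NormedSpace ℝ V] : Type _ :=
  V → V →L[ℝ] V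

/-- The 2-form `Ω(v, w) = h(v, J w)`. -/
def kahlerForm (h : BilinField V) (J : EndField V) (x v w : V) : ℝ := h x v (J x w)

/-- The Nijenhuis tensor `[JX, JY] - J[JX, Y] - J[X, JY] - [X, Y]` at the point `x`. -/
def nijenhuis (J : EndField V) (X Y : V → V) (x : V) : V :=
  VectorField.lieBracket ℝ (fun y => J y (X y)) (fun y => J y (Y y)) x
    - J x (VectorField.lieBracket ℝ (fun y => J y (X y)) Y x)
    - J x (VectorField.lieBracket ℝ X (fun y => J y (Y y)) x)
    - VectorField.lieBracket ℝ X Y x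

/-- `(h, J)` is a Kähler structure on the (open) set `U`: `h` is a smooth Riemannian metric, `J` is
a smooth integrable `h`-orthogonal complex structure, and `Ω = h(·, J ·)` is closed. -/
structure IsKahlerOn (U : Set V) (h : BilinField V) (J : EndField V) : Prop where
  smooth_metric : ContDiffOn ℝ ∞ h U
  smooth_complex : ContDiffOn ℝ ∞ J U
  symm : ∀ x ∈ U, ∀ v w, h x v w = h x w v
  pos : ∀ x ∈ U, ∀ v, v ≠ 0 → 0 < h x v v
  sq_neg : ∀ x ∈ U, ∀ v, J x (J x v) = -v
  orthogonal : ∀ x ∈ U, ∀ v w, h x (J x v) (J x w) = h x v w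
  integrable : ∀ X Y : V → V, ContDiffOn ℝ ∞ X U → ContDiffOn ℝ ∞ Y U →
    ∀ x ∈ U, nijenhuis J X Y x = 0
  closed : ∀ x ∈ U, ∀ u v w,
    fderiv ℝ (fun y => kahlerForm h J y v w) x u
      + fderiv ℝ (fun y => kahlerForm h J y w u) x v
      + fderiv ℝ (fun y => kahlerForm h J y u v) x w = 0

end General

/-! ### The cylinder `(0, R) × SU(2)`

`SU(2)` is the group of unit quaternions, and `(ρ, q) ∈ (0, R) × SU(2)` is identified with the
quaternion `ρ q`, so that `ρ = ‖x‖`.  The symmetry group `SU(2)` acts by right multiplication. -/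

/-- `(0, R) × SU(2)`, where `0 < R ≤ ∞`. -/
def cylinder (R : ℝ≥0∞) : Set ℍ[ℝ] := {x | x ≠ 0 ∧ ‖x‖ₑ < R}

/-- The interval `(0, R)`, where `0 < R ≤ ∞`. -/
def radii (R : ℝ≥0∞) : Set ℝ := {ρ | 0 < ρ ∧ ENNReal.ofReal ρ < R}

/-- Invariance of the Kähler structure under the right action of `SU(2)`. -/
def IsSU2Invariant (U : Set ℍ[ℝ]) (h : BilinField ℍ[ℝ]) (J : EndField ℍ[ℝ]) : Prop :=
  ∀ q : ℍ[ℝ], ‖q‖ = 1 → ∀ x ∈ U, ∀ v w,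
    h (x * q) (v * q) (w * q) = h x v w ∧ J (x * q) (v * q) = J x v * q

/-- The imaginary units `i, j, k`. -/
def imUnit : Fin 3 → ℍ[ℝ] := ![⟨0, 1, 0, 0⟩, ⟨0, 0, 1, 0⟩, ⟨0, 0, 0, 1⟩]

/-- The coefficients of `i, j, k`. -/
def imCoeff : Fin 3 → ℍ[ℝ] → ℝ := ![fun q => q.imI, fun q => q.imJ, fun q => q.imK]

/-- The 1-form `dρ`, for `ρ = ‖x‖`. -/
def dRho (x v : ℍ[ℝ]) : ℝ := inner ℝ x v / ‖x‖

/-- The right-invariant 1-forms, normalised by `dσ_i = -(1/2) ε_{ijk} σ_j ∧ σ_k`. -/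
def sigma (i : Fin 3) (x v : ℍ[ℝ]) : ℝ := -2 * imCoeff i (v * x⁻¹)

/-- The dual vector fields (generators of the left action), `[L_i, L_j] = ε_{ijk} L_k`. -/
def leftGen (i : Fin 3) (x : ℍ[ℝ]) : ℍ[ℝ] := (-(1 / 2) : ℝ) • (imUnit i * x)

/-- The 1-form `e^i = ∑ j, E^i_j(ρ) σ_j`. -/
def coframe (E : ℝ → Matrix (Fin 3) (Fin 3) ℝ) (i : Fin 3) (x v : ℍ[ℝ]) : ℝ :=
  ∑ j, E ‖x‖ i j * sigma j x v

/-- On `(0, R) × SU(2)`, the forms `dρ, e¹, e², e³` are an orthonormal coframe of `h`, positive for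
the orientation `dρ ∧ σ₁ ∧ σ₂ ∧ σ₃`, and `Ω = dρ ∧ e³ - e¹ ∧ e²`.  (Indices run over `0, 1, 2`.) -/
structure HasAdaptedCoframe (R : ℝ≥0∞) (h : BilinField ℍ[ℝ]) (J : EndField ℍ[ℝ])
    (E : ℝ → Matrix (Fin 3) (Fin 3) ℝ) : Prop where
  oriented : ∀ ρ ∈ radii R, 0 < (E ρ).det
  metric_eq : ∀ x ∈ cylinder R, ∀ v w,
    h x v w = dRho x v * dRho x w + ∑ i, coframe E i x v * coframe E i x w
  form_eq : ∀ x ∈ cylinder R, ∀ v w,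
    kahlerForm h J x v w =
      (dRho x v * coframe E 2 x w - dRho x w * coframe E 2 x v)
        - (coframe E 0 x v * coframe E 1 x w - coframe E 0 x w * coframe E 1 x v)

/-! ### Nuts and bolts at `ρ = 0` -/

/-- The metric extends smoothly to a nut at `ρ = 0`: the orbit at `ρ = 0` is a point, around which
the space is the ball of radius `R` in `ℝ⁴ = ℍ`. -/
def SmoothAtNut (R : ℝ≥0∞) (h : BilinField ℍ[ℝ]) : Prop :=
  ∃ H : BilinField ℍ[ℝ], ContDiffOn ℝ ∞ H {x | ‖x‖ₑ < R} ∧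
    (∀ v, v ≠ 0 → 0 < H 0 v v) ∧ ∀ x ∈ cylinder R, H x = h x

/-- The inclusion `ℂ ⊂ ℍ` that sends the imaginary unit to `k`; `L₃` generates left multiplication
by its unit circle. -/
def ofC (t : ℂ) : ℍ[ℝ] := ⟨t.re, 0, 0, t.im⟩

/-- `(t, u) ↦ t s(u)` where `s(u) = (1 + u i) / √(1 + |u|²)` is a local section of
`SU(2) → U(1) \ SU(2) = S²`; here `ρ = |t|`, and `u` is an affine coordinate on `S²`. -/
def hopfChart (z : ℂ × ℂ) : ℍ[ℝ] :=
  (Real.sqrt (1 + ‖z.2‖ ^ 2))⁻¹ • (ofC z.1 * (1 + ofC z.2 * imUnit 0))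

/-- `(ρ e^{iθ}, u) ↦ (ρ e^{ipθ}, u)`, the quotient by the subgroup `ℤ_p` of the circle. -/
def windMap (p : ℕ) (z : ℂ × ℂ) : ℂ × ℂ := (‖z.1‖ * (z.1 / ‖z.1‖) ^ p, z.2)

/-- The metric on `(0, R) × SU(2)/ℤ_p` extends smoothly to a bolt at `ρ = 0`: the circle generated by
`L₃` collapses there, and the space is an `ℝ²`-bundle over the bolt `S²` with fibre coordinate
`ρ e^{ipθ}`.  By `SU(2)`-homogeneity of the bolt, it is enough to consider one chart. -/
def SmoothAtBolt (R : ℝ≥0∞) (p : ℕ) (h : BilinField ℍ[ℝ]) : Prop :=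
  ∃ H : BilinField (ℂ × ℂ), ContDiffOn ℝ ∞ H {z | ‖z.1‖ₑ < R} ∧
    (∀ u v, v ≠ 0 → 0 < H (0, u) v v) ∧
    ∀ z : ℂ × ℂ, z.1 ≠ 0 → ‖z.1‖ₑ < R → ∀ v w,
      H (windMap p z) (fderiv ℝ (windMap p) z v) (fderiv ℝ (windMap p) z w) =
        h (hopfChart z) (fderiv ℝ hopfChart z v) (fderiv ℝ hopfChart z w)

/-- Bolt I (complex bolt): the metric extends smoothly to a bolt, and `J` preserves the tangent
planes of the bolt.  These are spanned by `L₁, L₂`, so this says that `Ω` between the normal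
direction `∂_ρ` and `L₁, L₂` vanishes at the bolt. -/
def SmoothAtBoltI (R : ℝ≥0∞) (h : BilinField ℍ[ℝ]) (J : EndField ℍ[ℝ]) : Prop :=
  (∃ p : ℕ, 1 ≤ p ∧ SmoothAtBolt R p h) ∧
    ∀ q : ℍ[ℝ], ‖q‖ = 1 → ∀ i : Fin 3, i ≠ 2 →
      Filter.Tendsto (fun ρ : ℝ => kahlerForm h J (ρ • q) q (leftGen i (ρ • q))) (𝓝[>] 0) (𝓝 0)

/-- Besides the right action of `SU(2)`, the Kähler structure is invariant under a circle subgroup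
`{cos θ + sin θ n}` of the left action. -/
def HasU1SU2Symmetry (R : ℝ≥0∞) (h : BilinField ℍ[ℝ]) (J : EndField ℍ[ℝ]) : Prop :=
  IsSU2Invariant (cylinder R) h J ∧
    ∃ n : ℍ[ℝ], n.re = 0 ∧ ‖n‖ = 1 ∧ ∀ θ : ℝ, ∀ g : ℍ[ℝ],
      g = (Real.cos θ : ℍ[ℝ]) + Real.sin θ • n →
      ∀ x ∈ cylinder R, ∀ v w,
        h (g * x) (g * v) (g * w) = h x v w ∧ J (g * x) (g * v) = g * J x v

end SU2Kahler

end

open SU2Kahler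

/-!
A Kähler structure that is invariant under the right action of `SU(2)` is determined by its values
at the points `(ρ, 1)`, hence by the matrix `E ρ`, up to `ρ`-dependent rotations of the first two
rows. Let `X₀, X₁, X₂` be the basis of `ℝ³` dual to the rows `E₀, E₁, E₂`, and `w = E₀ × E₁`.

Closedness of `Ω` says that `w' = E₂` (`hasDerivAt_cof_two`), and integrability of `J` gives the
derivative of the complex line spanned by `X₀ - i X₁` (`exists_hasDerivAt_complexStructure`,
`exists_planeField`). Only these objects are known to be differentiable, since the first two rows
may be rotated arbitrarily. So the argument uses two functions that do not change under such
rotations: `roundness (E ρ)`, with values in `(0, 1]`, is `1` if and only if `X₀, X₁` are orthogonal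
of equal length, and `tilt (E ρ) ≥ 0` is `0` if and only if `w` is parallel to `E₂`. They satisfy
`roundness' = (2 / |E₂|) (1 - roundness²)` and `tilt' = -(2 roundness / |E₂|) tilt`
(`hasDerivAt_roundness_tilt`), and near `ρ = 0` both are bounded: `tilt ≤ |w|²`, which is increasing
because `w ⬝ w' = det E > 0`. If the integral of `1 / |E₂|` diverges at `ρ = 0`, then a value of
`roundness` below `1`, or a positive value of `tilt`, would force that function to be unbounded near
`ρ = 0`. Hence `roundness = 1` and `tilt = 0` (`roundness_eq_one`, `tilt_eq_zero`).

The boundary conditions are used only through the bound `|E₂| = O(ρ log (1 / ρ))` (`SlowAtZero`),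
which makes the integral diverge. At a nut, `|E₂| = O(ρ)` because the metric is bounded. At a bolt,
smoothness gives the leading terms of `Eᵀ E` (`boltAsymptotics_of_smoothAtBolt`). Together with
`w' = E₂` and `det(E) E₂ = Eᵀ E w` these turn into the singular equations
`wᵢ' = (2 / (p ρ)) wᵢ + O(ρ)` for the two components of `w` along the bolt, and for a complex bolt `wᵢ = o(ρ)` (`bolt_ode`). So
`wᵢ' = O(ρ)` for `p ≥ 2`; for `p = 1` the equation is resonant and a logarithm appears.

Finally, if `roundness = 1` and `tilt = 0`, then `w' = E₂` is parallel to `w`, so `w` has a constant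
direction (`axis_const`), and `h` and `Ω`, and with them `J`, are invariant under the rotations
about this axis, which come from the left action of a circle (`hasU1SU2Symmetry_of_round`). For a
triangular coframe the axis is the third coordinate axis, and the remaining claims follow by
comparing coefficients (`triangular_of_round`).
-/

noncomputable section

namespace SU2Kahler

open scoped Quaternion ContDiff Topology ENNReal Matrix
open Filter Asymptotics

variable {R : ℝ≥0∞} {h : BilinField ℍ[ℝ]} {J : EndField ℍ[ℝ]}
  {E : ℝ → Matrix (Fin 3) (Fin 3) ℝ}

/-! ### Vectors, imaginary quaternions and dual frames -/

/-- The imaginary part of a quaternion, as a vector in `ℝ³`. -/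
def vec (q : ℍ[ℝ]) : Fin 3 → ℝ := fun i => imCoeff i q

/-- The imaginary quaternion with a given vector of coefficients. -/
def imQ (y : Fin 3 → ℝ) : ℍ[ℝ] := ⟨0, y 0, y 1, y 2⟩

@[simp] lemma vec_zero_apply (q : ℍ[ℝ]) : vec q 0 = q.imI := rfl
@[simp] lemma vec_one_apply (q : ℍ[ℝ]) : vec q 1 = q.imJ := rfl
@[simp] lemma vec_two_apply (q : ℍ[ℝ]) : vec q 2 = q.imK := rfl

@[simp] lemma re_imQ (y : Fin 3 → ℝ) : (imQ y).re = 0 := rfl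
@[simp] lemma imI_imQ (y : Fin 3 → ℝ) : (imQ y).imI = y 0 := rfl
@[simp] lemma imJ_imQ (y : Fin 3 → ℝ) : (imQ y).imJ = y 1 := rfl
@[simp] lemma imK_imQ (y : Fin 3 → ℝ) : (imQ y).imK = y 2 := rfl

@[simp] lemma vec_imQ (y : Fin 3 → ℝ) : vec (imQ y) = y := by
  ext i; fin_cases i <;> rfl

lemma re_coe_add_imQ (r : ℝ) (y : Fin 3 → ℝ) : ((r : ℍ[ℝ]) + imQ y).re = r := by simp

lemma vec_coe_add_imQ (r : ℝ) (y : Fin 3 → ℝ) : vec ((r : ℍ[ℝ]) + imQ y) = y := by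
  ext i; fin_cases i <;> simp

lemma vec3_ext {y z : Fin 3 → ℝ} (h0 : y 0 = z 0) (h1 : y 1 = z 1) (h2 : y 2 = z 2) : y = z := by
  ext i; fin_cases i <;> assumption

lemma dot3 (y z : Fin 3 → ℝ) : y ⬝ᵥ z = y 0 * z 0 + y 1 * z 1 + y 2 * z 2 := by
  simp [dotProduct, Fin.sum_univ_three]

@[simp] lemma cross_zero_apply (y z : Fin 3 → ℝ) : (y ⨯₃ z) 0 = y 1 * z 2 - y 2 * z 1 := by
  simp [cross_apply]
@[simp] lemma cross_one_apply (y z : Fin 3 → ℝ) : (y ⨯₃ z) 1 = y 2 * z 0 - y 0 * z 2 := by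
  simp [cross_apply]
@[simp] lemma cross_two_apply (y z : Fin 3 → ℝ) : (y ⨯₃ z) 2 = y 0 * z 1 - y 1 * z 0 := by
  simp [cross_apply]

/-- The rows of the cofactor matrix of `M`. -/
def cof (M : Matrix (Fin 3) (Fin 3) ℝ) (i : Fin 3) : Fin 3 → ℝ := M (i + 1) ⨯₃ M (i + 2)

/-- The basis of `ℝ³` dual to the rows of `M`. -/
def dualVec (M : Matrix (Fin 3) (Fin 3) ℝ) (i : Fin 3) : Fin 3 → ℝ := M.det⁻¹ • cof M i

lemma cof_zero (M : Matrix (Fin 3) (Fin 3) ℝ) : cof M 0 = M 1 ⨯₃ M 2 := rfl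
lemma cof_one (M : Matrix (Fin 3) (Fin 3) ℝ) : cof M 1 = M 2 ⨯₃ M 0 := rfl
lemma cof_two (M : Matrix (Fin 3) (Fin 3) ℝ) : cof M 2 = M 0 ⨯₃ M 1 := rfl

lemma row_dot_cof (M : Matrix (Fin 3) (Fin 3) ℝ) (i j : Fin 3) :
    M i ⬝ᵥ cof M j = if i = j then M.det else 0 := by
  rw [Matrix.det_fin_three]
  fin_cases i <;> fin_cases j <;> simp [cof_zero, cof_one, cof_two, dot3] <;> ring

lemma row_dot_dualVec {M : Matrix (Fin 3) (Fin 3) ℝ} (hM : M.det ≠ 0) (i j : Fin 3) :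
    M i ⬝ᵥ dualVec M j = if i = j then 1 else 0 := by
  rw [dualVec, dotProduct_smul, row_dot_cof]
  split_ifs <;> simp [hM]

lemma sum_dualVec {M : Matrix (Fin 3) (Fin 3) ℝ} (hM : M.det ≠ 0) (y : Fin 3 → ℝ) :
    y = (M 0 ⬝ᵥ y) • dualVec M 0 + (M 1 ⬝ᵥ y) • dualVec M 1 + (M 2 ⬝ᵥ y) • dualVec M 2 := by
  have h : M.det • y = (M 0 ⬝ᵥ y) • cof M 0 + (M 1 ⬝ᵥ y) • cof M 1 + (M 2 ⬝ᵥ y) • cof M 2 := by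
    rw [Matrix.det_fin_three]
    apply vec3_ext <;> simp [cof_zero, cof_one, cof_two, dot3] <;> ring
  calc y = M.det⁻¹ • (M.det • y) := by rw [smul_smul, inv_mul_cancel₀ hM, one_smul]
    _ = _ := by rw [h]; simp only [dualVec, smul_add, smul_comm M.det⁻¹]

/-- The complex structure on the plane spanned by the first two vectors of the dual basis,
extended by zero to the third one. -/
def planeJ (M : Matrix (Fin 3) (Fin 3) ℝ) (y : Fin 3 → ℝ) : Fin 3 → ℝ :=
  (M 0 ⬝ᵥ y) • dualVec M 1 - (M 1 ⬝ᵥ y) • dualVec M 0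

lemma planeJ_dualVec_zero {M : Matrix (Fin 3) (Fin 3) ℝ} (hM : M.det ≠ 0) :
    planeJ M (dualVec M 0) = dualVec M 1 := by
  simp [planeJ, row_dot_dualVec hM]

lemma planeJ_dualVec_one {M : Matrix (Fin 3) (Fin 3) ℝ} (hM : M.det ≠ 0) :
    planeJ M (dualVec M 1) = -dualVec M 0 := by
  simp [planeJ, row_dot_dualVec hM]

lemma cross_rows_dot_cross (M : Matrix (Fin 3) (Fin 3) ℝ) (y z : Fin 3 → ℝ) :
    (M 0 ⬝ᵥ y) * (M 1 ⬝ᵥ z) - (M 0 ⬝ᵥ z) * (M 1 ⬝ᵥ y) = cof M 2 ⬝ᵥ (y ⨯₃ z) := by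
  simp [cof_two, dot3]; ring

/-! ### The Kähler structure in terms of the coframe -/

lemma dRho_mul (x a : ℍ[ℝ]) : dRho x (a * x) = ‖x‖ * a.re := by
  rcases eq_or_ne x 0 with rfl | hx
  · simp [dRho]
  have h1 : (inner ℝ x (a * x) : ℝ) = ‖x‖ * ‖x‖ * a.re := by
    rw [← Quaternion.normSq_eq_norm_mul_self, real_inner_comm, Quaternion.inner_def, mul_assoc,
      Quaternion.self_mul_star]
    simp [mul_comm]
  rw [dRho, h1]
  field_simp

lemma coframe_mul (E : ℝ → Matrix (Fin 3) (Fin 3) ℝ) (i : Fin 3) {x : ℍ[ℝ]} (hx : x ≠ 0)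
    (a : ℍ[ℝ]) : coframe E i x (a * x) = -2 * (E ‖x‖ i ⬝ᵥ vec a) := by
  simp only [coframe, sigma, mul_assoc, mul_inv_cancel₀ hx, mul_one, dotProduct, vec,
    Finset.mul_sum]
  exact Finset.sum_congr rfl fun j _ => by ring

lemma mem_cylinder_iff {x : ℍ[ℝ]} : x ∈ cylinder R ↔ ‖x‖ ∈ radii R := by
  simp [cylinder, radii, ofReal_norm]

lemma coe_mem_cylinder {ρ : ℝ} (hρ : ρ ∈ radii R) : (ρ : ℍ[ℝ]) ∈ cylinder R := by
  rw [mem_cylinder_iff, Quaternion.norm_coe, Real.norm_of_nonneg hρ.1.le]; exact hρ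

lemma norm_coe_of_pos {ρ : ℝ} (hρ : 0 < ρ) : ‖(ρ : ℍ[ℝ])‖ = ρ := by
  rw [Quaternion.norm_coe, Real.norm_of_nonneg hρ.le]

/-- Every tangent vector at `x` has the form `a * x`, where the real part of `a` is the radial
component and the imaginary part is the component along the orbit. -/
lemma metric_mul (hE : HasAdaptedCoframe R h J E) {x : ℍ[ℝ]} (hx : x ∈ cylinder R) (a b : ℍ[ℝ]) :
    h x (a * x) (b * x) = ‖x‖ ^ 2 * (a.re * b.re)
      + 4 * ∑ i, (E ‖x‖ i ⬝ᵥ vec a) * (E ‖x‖ i ⬝ᵥ vec b) := by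
  rw [hE.metric_eq x hx]
  simp only [dRho_mul, coframe_mul E _ hx.1, Finset.mul_sum]
  congr 1
  · ring
  · exact Finset.sum_congr rfl fun j _ => by ring

lemma form_mul (hE : HasAdaptedCoframe R h J E) {x : ℍ[ℝ]} (hx : x ∈ cylinder R) (a b : ℍ[ℝ]) :
    kahlerForm h J x (a * x) (b * x) =
      -2 * ‖x‖ * (a.re * (E ‖x‖ 2 ⬝ᵥ vec b) - b.re * (E ‖x‖ 2 ⬝ᵥ vec a))
        - 4 * (cof (E ‖x‖) 2 ⬝ᵥ (vec a ⨯₃ vec b)) := by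
  rw [hE.form_eq x hx, ← cross_rows_dot_cross]
  simp only [dRho_mul, coframe_mul E _ hx.1]
  ring

lemma inv_smul_mul_coe (ρ : ℝ) (hρ : ρ ≠ 0) (v : ℍ[ℝ]) : (ρ⁻¹ • v) * (ρ : ℍ[ℝ]) = v := by
  rw [smul_mul_assoc, ← Quaternion.coe_commutes, Quaternion.coe_mul_eq_smul, smul_smul,
    inv_mul_cancel₀ hρ, one_smul]

lemma vec_smul (r : ℝ) (v : ℍ[ℝ]) : vec (r • v) = r • vec v := by
  apply vec3_ext <;> simp

lemma metric_real (hE : HasAdaptedCoframe R h J E) {ρ : ℝ} (hρ : ρ ∈ radii R) (a b : ℍ[ℝ]) :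
    h (ρ : ℍ[ℝ]) a b = a.re * b.re
      + 4 / ρ ^ 2 * ∑ i, (E ρ i ⬝ᵥ vec a) * (E ρ i ⬝ᵥ vec b) := by
  have h0 : ρ ≠ 0 := hρ.1.ne'
  have := metric_mul hE (coe_mem_cylinder hρ) (ρ⁻¹ • a) (ρ⁻¹ • b)
  rw [inv_smul_mul_coe _ h0, inv_smul_mul_coe _ h0, norm_coe_of_pos hρ.1] at this
  rw [this]
  simp only [vec_smul, dotProduct_smul, Quaternion.re_smul, smul_eq_mul, Fin.sum_univ_three]
  field_simp

lemma form_real (hE : HasAdaptedCoframe R h J E) {ρ : ℝ} (hρ : ρ ∈ radii R) (a b : ℍ[ℝ]) :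
    kahlerForm h J (ρ : ℍ[ℝ]) a b =
      -2 / ρ * (a.re * (E ρ 2 ⬝ᵥ vec b) - b.re * (E ρ 2 ⬝ᵥ vec a))
        - 4 / ρ ^ 2 * (cof (E ρ) 2 ⬝ᵥ (vec a ⨯₃ vec b)) := by
  have h0 : ρ ≠ 0 := hρ.1.ne'
  have := form_mul hE (coe_mem_cylinder hρ) (ρ⁻¹ • a) (ρ⁻¹ • b)
  rw [inv_smul_mul_coe _ h0, inv_smul_mul_coe _ h0, norm_coe_of_pos hρ.1] at this
  rw [this]
  simp only [vec_smul, dotProduct_smul, Quaternion.re_smul, smul_eq_mul, map_smul,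
    LinearMap.smul_apply]
  field_simp

lemma vec_add (a b : ℍ[ℝ]) : vec (a + b) = vec a + vec b := by
  apply vec3_ext <;> simp

/-- The complex structure at the point `(ρ, 1)`: it maps the radial direction to the one of `X₂`,
and it acts on the plane of `X₀, X₁` as `planeJ`. -/
lemma complexStructure_real (hK : IsKahlerOn (cylinder R) h J) (hE : HasAdaptedCoframe R h J E)
    {ρ : ℝ} (hρ : ρ ∈ radii R) (b : ℍ[ℝ]) :
    J (ρ : ℍ[ℝ]) b = ((-2 / ρ * (E ρ 2 ⬝ᵥ vec b) : ℝ) : ℍ[ℝ])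
      + imQ ((ρ / 2 * b.re) • dualVec (E ρ) 2 + planeJ (E ρ) (vec b)) := by
  have hx := coe_mem_cylinder hρ
  have hd : (E ρ).det ≠ 0 := (hE.oriented ρ hρ).ne'
  set c := ((-2 / ρ * (E ρ 2 ⬝ᵥ vec b) : ℝ) : ℍ[ℝ])
      + imQ ((ρ / 2 * b.re) • dualVec (E ρ) 2 + planeJ (E ρ) (vec b)) with hc
  have hvc : vec c = (ρ / 2 * b.re) • dualVec (E ρ) 2 + planeJ (E ρ) (vec b) := by
    rw [hc, vec_coe_add_imQ]
  have hrc : c.re = -2 / ρ * (E ρ 2 ⬝ᵥ vec b) := by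
    rw [hc, re_coe_add_imQ]
  have key : ∀ a, h (ρ : ℍ[ℝ]) a (J (ρ : ℍ[ℝ]) b) = h (ρ : ℍ[ℝ]) a c := by
    intro a
    have h1 := form_real hE hρ a b
    rw [kahlerForm] at h1
    rw [h1, metric_real hE hρ, hvc, hrc, ← cross_rows_dot_cross]
    have h0 : ρ ≠ 0 := hρ.1.ne'
    simp only [Fin.sum_univ_three, dotProduct_add, planeJ, dotProduct_sub, dotProduct_smul,
      row_dot_dualVec hd, smul_eq_mul]
    simp
    field_simp
    ring
  by_contra hne
  have hpos := hK.pos _ hx (J (ρ : ℍ[ℝ]) b - c) (sub_ne_zero.2 hne)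
  rw [map_sub, key, sub_self] at hpos
  exact lt_irrefl _ hpos

lemma re_complexStructure_real (hK : IsKahlerOn (cylinder R) h J)
    (hE : HasAdaptedCoframe R h J E) {ρ : ℝ} (hρ : ρ ∈ radii R) (b : ℍ[ℝ]) :
    (J (ρ : ℍ[ℝ]) b).re = -2 / ρ * (E ρ 2 ⬝ᵥ vec b) := by
  rw [complexStructure_real hK hE hρ, re_coe_add_imQ]

lemma vec_complexStructure_real (hK : IsKahlerOn (cylinder R) h J)
    (hE : HasAdaptedCoframe R h J E) {ρ : ℝ} (hρ : ρ ∈ radii R) (b : ℍ[ℝ]) :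
    vec (J (ρ : ℍ[ℝ]) b) = (ρ / 2 * b.re) • dualVec (E ρ) 2 + planeJ (E ρ) (vec b) := by
  rw [complexStructure_real hK hE hρ, vec_coe_add_imQ]

/-! ### Differentiation along the orbits and across them -/

lemma hasDerivAt_dotProduct {f g : ℝ → Fin 3 → ℝ} {f' g' : Fin 3 → ℝ} {s : ℝ}
    (hf : HasDerivAt f f' s) (hg : HasDerivAt g g' s) :
    HasDerivAt (fun s => f s ⬝ᵥ g s) (f' ⬝ᵥ g s + f s ⬝ᵥ g') s := by
  simp only [dot3]
  rw [hasDerivAt_pi] at hf hg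
  exact ((((hf 0).mul (hg 0)).add ((hf 1).mul (hg 1))).add ((hf 2).mul (hg 2))).congr_deriv
    (by ring)

lemma hasDerivAt_dotProduct_const {f : ℝ → Fin 3 → ℝ} {f' : Fin 3 → ℝ} {s : ℝ}
    (hf : HasDerivAt f f' s) (y : Fin 3 → ℝ) :
    HasDerivAt (fun s => f s ⬝ᵥ y) (f' ⬝ᵥ y) s := by
  simpa using hasDerivAt_dotProduct hf (hasDerivAt_const s y)

lemma isOpen_radii (R : ℝ≥0∞) : IsOpen (radii R) :=
  (isOpen_lt continuous_const continuous_id).inter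
    (isOpen_lt ENNReal.continuous_ofReal continuous_const)

lemma ordConnected_radii (R : ℝ≥0∞) : (radii R).OrdConnected :=
  ⟨fun _ ha _ hb _ hc => ⟨ha.1.trans_le hc.1, (ENNReal.ofReal_le_ofReal hc.2).trans_lt hb.2⟩⟩

lemma mem_radii_of_le {ρ ρ' : ℝ} (hρ : ρ ∈ radii R) (h0 : 0 < ρ') (hle : ρ' ≤ ρ) :
    ρ' ∈ radii R :=
  ⟨h0, (ENNReal.ofReal_le_ofReal hle).trans_lt hρ.2⟩

lemma isOpen_cylinder (R : ℝ≥0∞) : IsOpen (cylinder R) :=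
  isOpen_ne.inter (isOpen_lt continuous_enorm continuous_const)

lemma hasDerivAt_coe (ρ : ℝ) : HasDerivAt (fun s : ℝ => (s : ℍ[ℝ])) 1 ρ := by
  have : (fun s : ℝ => (s : ℍ[ℝ])) = fun s => s • (1 : ℍ[ℝ]) := by
    ext s : 1; rw [← Quaternion.coe_mul_eq_smul, mul_one]
  rw [this]
  simpa using (hasDerivAt_id ρ).smul_const (1 : ℍ[ℝ])

/-- The imaginary part as a continuous linear map. -/
def vecL : ℍ[ℝ] →L[ℝ] Fin 3 → ℝ :=
  LinearMap.toContinuousLinearMap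
    { toFun := vec, map_add' := vec_add, map_smul' := vec_smul }

@[simp] lemma vecL_apply (q : ℍ[ℝ]) : vecL q = vec q := rfl

/-- The real part as a continuous linear map. -/
def reL : ℍ[ℝ] →L[ℝ] ℝ :=
  LinearMap.toContinuousLinearMap
    { toFun := fun q => q.re, map_add' := fun _ _ => rfl, map_smul' := fun _ _ => rfl }

@[simp] lemma reL_apply (q : ℍ[ℝ]) : reL q = q.re := rfl

/-- The inclusion of the imaginary quaternions as a continuous linear map. -/
def imQL : (Fin 3 → ℝ) →L[ℝ] ℍ[ℝ] :=
  LinearMap.toContinuousLinearMap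
    { toFun := imQ
      map_add' := fun y z => by ext <;> simp
      map_smul' := fun r y => by ext <;> simp }

@[simp] lemma imQL_apply (y : Fin 3 → ℝ) : imQL y = imQ y := rfl

lemma differentiableAt_complexStructure (hK : IsKahlerOn (cylinder R) h J) {x : ℍ[ℝ]}
    (hx : x ∈ cylinder R) : DifferentiableAt ℝ J x :=
  (hK.smooth_complex.contDiffAt ((isOpen_cylinder R).mem_nhds hx)).differentiableAt (by simp)

lemma differentiableAt_metric (hK : IsKahlerOn (cylinder R) h J) {x : ℍ[ℝ]}
    (hx : x ∈ cylinder R) : DifferentiableAt ℝ h x :=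
  (hK.smooth_metric.contDiffAt ((isOpen_cylinder R).mem_nhds hx)).differentiableAt (by simp)

lemma differentiableAt_kahlerForm (hK : IsKahlerOn (cylinder R) h J) {x : ℍ[ℝ]}
    (hx : x ∈ cylinder R) (a b : ℍ[ℝ]) :
    DifferentiableAt ℝ (fun y => kahlerForm h J y a b) x :=
  ((differentiableAt_metric hK hx).clm_apply (differentiableAt_const a)).clm_apply
    ((differentiableAt_complexStructure hK hx).clm_apply (differentiableAt_const b))

lemma eventually_mem_radii {ρ : ℝ} (hρ : ρ ∈ radii R) : ∀ᶠ s in 𝓝 ρ, s ∈ radii R :=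
  (isOpen_radii R).mem_nhds hρ

/-- The third row of the coframe is differentiable, even where the first two are not. -/
lemma exists_hasDerivAt_row (hK : IsKahlerOn (cylinder R) h J) (hE : HasAdaptedCoframe R h J E)
    {ρ : ℝ} (hρ : ρ ∈ radii R) : ∃ v' : Fin 3 → ℝ, HasDerivAt (fun s => E s 2) v' ρ := by
  have hJ : ∀ b : ℍ[ℝ], DifferentiableAt ℝ (fun s : ℝ => J (s : ℍ[ℝ]) b) ρ := fun b =>
    (DifferentiableAt.comp ρ (g := J) (differentiableAt_complexStructure hK (coe_mem_cylinder hρ))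
      (hasDerivAt_coe ρ).differentiableAt).clm_apply (differentiableAt_const b)
  have : DifferentiableAt ℝ (fun s => E s 2) ρ := by
    rw [differentiableAt_pi]
    intro k
    have h1 : DifferentiableAt ℝ
        (fun s : ℝ => -(s / 2) * reL (J (s : ℍ[ℝ]) (imQ (Pi.single k 1)))) ρ :=
      (differentiableAt_id.div_const 2).neg.mul (reL.differentiableAt.comp ρ (hJ _))
    refine h1.congr_of_eventuallyEq ?_
    filter_upwards [eventually_mem_radii hρ] with s hs
    have h0 : s ≠ 0 := hs.1.ne'
    rw [reL_apply, re_complexStructure_real hK hE hs, vec_imQ, dotProduct_single]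
    field_simp
  exact ⟨_, this.hasDerivAt⟩

lemma exists_hasDerivAt_cof (hK : IsKahlerOn (cylinder R) h J) (hE : HasAdaptedCoframe R h J E)
    {ρ : ℝ} (hρ : ρ ∈ radii R) : ∃ w' : Fin 3 → ℝ, HasDerivAt (fun s => cof (E s) 2) w' ρ := by
  have key : ∀ a b : Fin 3 → ℝ,
      DifferentiableAt ℝ (fun s => cof (E s) 2 ⬝ᵥ (a ⨯₃ b)) ρ := by
    intro a b
    have h1 : DifferentiableAt ℝ
        (fun s : ℝ => -(s ^ 2 / 4) * kahlerForm h J (s : ℍ[ℝ]) (imQ a) (imQ b)) ρ :=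
      ((differentiableAt_id.pow 2).div_const 4).neg.mul (DifferentiableAt.comp ρ
        (g := fun y => kahlerForm h J y (imQ a) (imQ b))
        (differentiableAt_kahlerForm hK (coe_mem_cylinder hρ) _ _)
        (hasDerivAt_coe ρ).differentiableAt)
    refine h1.congr_of_eventuallyEq ?_
    filter_upwards [eventually_mem_radii hρ] with s hs
    have h0 : s ≠ 0 := hs.1.ne'
    rw [form_real hE hs]
    simp only [re_imQ, vec_imQ]
    field_simp
    ring
  have : DifferentiableAt ℝ (fun s => cof (E s) 2) ρ := by
    rw [differentiableAt_pi]
    intro k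
    fin_cases k
    · simpa [dot3] using key ![0, 1, 0] ![0, 0, 1]
    · simpa [dot3] using key ![0, 0, 1] ![1, 0, 0]
    · simpa [dot3] using key ![1, 0, 0] ![0, 1, 0]
  exact ⟨_, this.hasDerivAt⟩

lemma hasDerivAt_comp_line {T : ℍ[ℝ] → ℝ} {x : ℍ[ℝ]} (hT : DifferentiableAt ℝ T x) (u : ℍ[ℝ]) :
    HasDerivAt (fun s : ℝ => T (x + s • u)) (fderiv ℝ T x u) 0 := by
  have h1 : HasDerivAt (fun s : ℝ => x + s • u) u 0 := by
    simpa using ((hasDerivAt_id (0 : ℝ)).smul_const u).const_add x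
  have h2 : HasFDerivAt T (fderiv ℝ T x) (x + (0 : ℝ) • u) := by simpa using hT.hasFDerivAt
  exact h2.comp_hasDerivAt 0 h1

lemma mul_inv_mul_eq (b : ℍ[ℝ]) {y : ℍ[ℝ]} (hy : y ≠ 0) :
    ((‖y‖ ^ 2)⁻¹ • (b * star y)) * y = b := by
  rw [smul_mul_assoc, mul_assoc, Quaternion.star_mul_self, Quaternion.normSq_eq_norm_mul_self,
    ← pow_two, ← Quaternion.coe_commutes, Quaternion.coe_mul_eq_smul, smul_smul,
    inv_mul_cancel₀ (by positivity), one_smul]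

/-- The derivative of `Ω(b, 1)` at a real point in an imaginary direction `a`, for constant vector
fields `b` and `1`; these are not invariant, so that the derivative is not zero. -/
lemma fderiv_kahlerForm_imaginary (hK : IsKahlerOn (cylinder R) h J)
    (hE : HasAdaptedCoframe R h J E) {ρ : ℝ} (hρ : ρ ∈ radii R) (a b : Fin 3 → ℝ) :
    fderiv ℝ (fun y => kahlerForm h J y (imQ b) 1) (ρ : ℍ[ℝ]) (imQ a)
      = 2 / ρ ^ 2 * (E ρ 2 ⬝ᵥ (a ⨯₃ b)) - 4 / ρ ^ 3 * (cof (E ρ) 2 ⬝ᵥ (a ⨯₃ b)) := by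
  have hx := coe_mem_cylinder hρ
  have h0 : ρ ≠ 0 := hρ.1.ne'
  obtain ⟨v', hv⟩ := exists_hasDerivAt_row hK hE hρ
  obtain ⟨w', hw⟩ := exists_hasDerivAt_cof hK hE hρ
  refine (hasDerivAt_comp_line (differentiableAt_kahlerForm hK hx (imQ b) 1) (imQ a)).unique ?_
  set n : ℝ → ℝ := fun s => ‖(ρ : ℍ[ℝ]) + s • imQ a‖ with hn
  have hn2 : ∀ s, n s = Real.sqrt (ρ ^ 2 + s ^ 2 * (a ⬝ᵥ a)) := by
    intro s
    have h1 : 0 ≤ ρ ^ 2 + s ^ 2 * (a ⬝ᵥ a) := by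
      rw [dot3]
      nlinarith [sq_nonneg (s * a 0), sq_nonneg (s * a 1), sq_nonneg (s * a 2)]
    rw [hn, eq_comm, Real.sqrt_eq_iff_mul_self_eq h1 (norm_nonneg _),
      ← Quaternion.normSq_eq_norm_mul_self, Quaternion.normSq_def']
    simp [dot3]; ring
  have hn0 : n 0 = ρ := by simp [hn, norm_coe_of_pos hρ.1]
  have hnd : HasDerivAt n 0 0 := by
    have h1 : HasDerivAt (fun s : ℝ => ρ ^ 2 + s ^ 2 * (a ⬝ᵥ a)) 0 0 := by
      simpa using (((hasDerivAt_id (0 : ℝ)).pow 2).mul_const (a ⬝ᵥ a)).const_add (ρ ^ 2)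
    have h2 := h1.sqrt (by simpa using h0)
    rw [show n = fun s => Real.sqrt (ρ ^ 2 + s ^ 2 * (a ⬝ᵥ a)) from funext hn2]
    simpa using h2
  -- The norm is stationary in imaginary directions, so all functions of the norm are.
  have hvn : HasDerivAt (fun s => E (n s) 2) 0 0 :=
    (HasDerivAt.scomp (g₁ := fun s => E s 2) (0 : ℝ) (by rw [hn0]; exact hv)
      hnd).congr_deriv (zero_smul ℝ v')
  have hwn : HasDerivAt (fun s => cof (E (n s)) 2) 0 0 :=
    (HasDerivAt.scomp (g₁ := fun s => cof (E s) 2) (0 : ℝ) (by rw [hn0]; exact hw)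
      hnd).congr_deriv (zero_smul ℝ w')
  have dv : ∀ y, HasDerivAt (fun s => E (n s) 2 ⬝ᵥ y) 0 0 := fun y => by
    simpa using hasDerivAt_dotProduct_const hvn y
  have dw : ∀ y, HasDerivAt (fun s => cof (E (n s)) 2 ⬝ᵥ y) 0 0 := fun y => by
    simpa using hasDerivAt_dotProduct_const hwn y
  have hid := hasDerivAt_id (0 : ℝ)
  -- This is `Ω(b, 1)` along the line, computed with `form_mul` from `b = (b y⁻¹) y`, where
  -- `y⁻¹ = n⁻² (ρ - s a)`.
  have hF := ((hnd.pow 4).inv (by simp [hn0, h0])).mul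
    ((((hnd.mul (dv b)).const_mul (2 * ρ ^ 2)).add
      (hid.mul (((dw (b ⨯₃ a)).const_mul (4 * ρ)).sub
        ((hnd.mul (dv (b ⨯₃ a))).const_mul (2 * ρ))))).add
      ((hid.mul hid).mul (((hnd.mul (dv a)).const_mul (2 * (a ⬝ᵥ b))).sub
        ((dw ((b ⨯₃ a) ⨯₃ a)).const_mul 4))))
  have hlim : Tendsto (fun s : ℝ => (ρ : ℍ[ℝ]) + s • imQ a) (𝓝 0) (𝓝 (ρ : ℍ[ℝ])) := by
    have : Continuous fun s : ℝ => (ρ : ℍ[ℝ]) + s • imQ a := by fun_prop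
    simpa using this.tendsto 0
  refine (hF.congr_of_eventuallyEq ?_).congr_deriv ?_
  · filter_upwards [hlim ((isOpen_cylinder R).mem_nhds hx)] with s hs
    have hs' : (ρ : ℍ[ℝ]) + s • imQ a ∈ cylinder R := hs
    have e := form_mul hE hs' ((n s ^ 2)⁻¹ • (imQ b * star ((ρ : ℍ[ℝ]) + s • imQ a)))
      ((n s ^ 2)⁻¹ • (1 * star ((ρ : ℍ[ℝ]) + s • imQ a)))
    rw [mul_inv_mul_eq _ hs'.1, mul_inv_mul_eq _ hs'.1] at e
    rw [e]
    have e1 : vec (imQ b * star ((ρ : ℍ[ℝ]) + s • imQ a)) = ρ • b - s • (b ⨯₃ a) := by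
      apply vec3_ext <;> simp <;> ring
    have e2 : vec (1 * star ((ρ : ℍ[ℝ]) + s • imQ a)) = -(s • a) := by
      apply vec3_ext <;> simp
    have e3 : (imQ b * star ((ρ : ℍ[ℝ]) + s • imQ a)).re = s * (a ⬝ᵥ b) := by
      simp [dot3]; ring
    have e4 : (1 * star ((ρ : ℍ[ℝ]) + s • imQ a)).re = ρ := by simp
    have hns : n s = ‖(ρ : ℍ[ℝ]) + s • imQ a‖ := rfl
    simp only [Pi.mul_apply, Pi.add_apply, Pi.sub_apply, Pi.inv_apply, Pi.pow_apply, id, vec_smul,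
      e1, e2, Quaternion.re_smul, e3, e4, ← hns, dotProduct_smul, dotProduct_sub, dotProduct_neg,
      map_smul, map_neg, map_sub, LinearMap.smul_apply, LinearMap.sub_apply, smul_eq_mul]
    rcases eq_or_ne (n s) 0 with h00 | h00
    · simp [h00]
    field_simp
    ring
  · simp only [Pi.mul_apply, Pi.add_apply, Pi.sub_apply, Pi.inv_apply, Pi.pow_apply, id, hn0]
    have e5 : ∀ z, z ⬝ᵥ (b ⨯₃ a) = -(z ⬝ᵥ (a ⨯₃ b)) := fun z => by
      rw [← cross_anticomm, dotProduct_neg]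
    simp [e5]
    field_simp
    ring

/-- Closedness of `Ω`: the derivative of the cofactor vector `E₀ × E₁` is the row `E₂`. -/
lemma hasDerivAt_cof_two (hK : IsKahlerOn (cylinder R) h J) (hE : HasAdaptedCoframe R h J E)
    {ρ : ℝ} (hρ : ρ ∈ radii R) : HasDerivAt (fun s => cof (E s) 2) (E ρ 2) ρ := by
  have hx := coe_mem_cylinder hρ
  have h0 : ρ ≠ 0 := hρ.1.ne'
  obtain ⟨w', hw⟩ := exists_hasDerivAt_cof hK hE hρ
  have key : ∀ a b : Fin 3 → ℝ, w' ⬝ᵥ (a ⨯₃ b) = E ρ 2 ⬝ᵥ (a ⨯₃ b) := by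
    intro a b
    have hc := hK.closed _ hx 1 (imQ a) (imQ b)
    have h1 : fderiv ℝ (fun y => kahlerForm h J y (imQ a) (imQ b)) (ρ : ℍ[ℝ]) 1
        = -4 / ρ ^ 2 * (w' ⬝ᵥ (a ⨯₃ b)) + 8 / ρ ^ 3 * (cof (E ρ) 2 ⬝ᵥ (a ⨯₃ b)) := by
      have d1 := (differentiableAt_kahlerForm hK hx (imQ a) (imQ b)).hasFDerivAt.comp_hasDerivAt
        ρ (hasDerivAt_coe ρ)
      refine d1.unique ?_
      have d2 := ((((hasDerivAt_id ρ).pow 2).inv (by simpa using h0)).mul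
        (hasDerivAt_dotProduct_const hw (a ⨯₃ b))).const_mul (-4)
      refine (d2.congr_of_eventuallyEq ?_).congr_deriv ?_
      · filter_upwards [eventually_mem_radii hρ] with s hs
        have h00 : s ≠ 0 := hs.1.ne'
        simp only [Function.comp, form_real hE hs, re_imQ, vec_imQ, Pi.mul_apply, Pi.inv_apply,
          Pi.pow_apply, id]
        field_simp
        ring
      · simp
        field_simp
        ring
    have h3 : (fun y => kahlerForm h J y 1 (imQ a)) =ᶠ[𝓝 (ρ : ℍ[ℝ])]
        fun y => -kahlerForm h J y (imQ a) 1 := by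
      filter_upwards [(isOpen_cylinder R).mem_nhds hx] with y hy
      rw [hE.form_eq y hy, hE.form_eq y hy]
      ring
    rw [h1, fderiv_kahlerForm_imaginary hK hE hρ, h3.fderiv_eq, fderiv_fun_neg,
      neg_apply, fderiv_kahlerForm_imaginary hK hE hρ,
      ← cross_anticomm a b, dotProduct_neg, dotProduct_neg] at hc
    field_simp at hc
    exact mul_left_cancel₀ h0 (by linarith)
  convert hw using 1
  apply vec3_ext
  · simpa [dot3] using (key ![0, 1, 0] ![0, 0, 1]).symm
  · simpa [dot3] using (key ![0, 0, 1] ![1, 0, 0]).symm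
  · simpa [dot3] using (key ![1, 0, 0] ![0, 1, 0]).symm

/-! ### Integrability along the orbits -/

lemma hasFDerivAt_norm_real {ρ : ℝ} (hρ : 0 < ρ) :
    HasFDerivAt (fun x : ℍ[ℝ] => ‖x‖) reL (ρ : ℍ[ℝ]) := by
  have h1 := (hasStrictFDerivAt_norm_sq (ρ : ℍ[ℝ])).hasFDerivAt.sqrt
    (by rw [norm_coe_of_pos hρ]; positivity)
  simp only [Real.sqrt_sq (norm_nonneg _)] at h1
  refine h1.congr_fderiv ?_
  ext a
  have h0 : ρ ≠ 0 := hρ.ne'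
  have : (inner ℝ (ρ : ℍ[ℝ]) a : ℝ) = ρ * a.re := by
    rw [Quaternion.inner_def]; simp
  simp [this, abs_of_pos hρ]
  field_simp

lemma hasFDerivAt_orbitField {f : ℝ → ℍ[ℝ]} {f' : ℍ[ℝ]} {ρ : ℝ} (hρ : 0 < ρ)
    (hf : HasDerivAt f f' ρ) :
    ∃ F' : ℍ[ℝ] →L[ℝ] ℍ[ℝ], HasFDerivAt (fun x : ℍ[ℝ] => f ‖x‖ * x) F' (ρ : ℍ[ℝ]) ∧
      ∀ a, F' a = (ρ * a.re) • f' + f ρ * a := by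
  have h1 : HasFDerivAt (fun x : ℍ[ℝ] => f ‖x‖) (reL.smulRight f') (ρ : ℍ[ℝ]) := by
    have h2 : HasFDerivAt f (ContinuousLinearMap.toSpanSingleton ℝ f') ‖(ρ : ℍ[ℝ])‖ := by
      rw [norm_coe_of_pos hρ]; exact hf.hasFDerivAt
    refine (h2.comp (ρ : ℍ[ℝ]) (hasFDerivAt_norm_real hρ)).congr_fderiv ?_
    ext a <;> simp
  refine ⟨_, h1.mul' (hasFDerivAt_id _), fun a => ?_⟩
  simp [abs_of_pos hρ]
  rw [← Quaternion.coe_commutes, Quaternion.coe_mul_eq_smul, smul_smul, add_comm,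
    mul_comm ρ]

/-- The Lie bracket of two vector fields that are invariant under the right action. -/
lemma lieBracket_orbitField {f k : ℝ → ℍ[ℝ]} {f' k' : ℍ[ℝ]} {ρ : ℝ} (hρ : 0 < ρ)
    (hf : HasDerivAt f f' ρ) (hk : HasDerivAt k k' ρ) :
    VectorField.lieBracket ℝ (fun x : ℍ[ℝ] => f ‖x‖ * x) (fun x : ℍ[ℝ] => k ‖x‖ * x) (ρ : ℍ[ℝ])
      = ρ • (ρ • ((f ρ).re • k' - (k ρ).re • f') + (k ρ * f ρ - f ρ * k ρ)) := by
  obtain ⟨F', hF, hF'⟩ := hasFDerivAt_orbitField hρ hf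
  obtain ⟨K', hK, hK'⟩ := hasFDerivAt_orbitField hρ hk
  rw [VectorField.lieBracket, hF.fderiv, hK.fderiv, hF', hK', norm_coe_of_pos hρ]
  simp only [← mul_assoc, ← Quaternion.coe_commutes ρ, Quaternion.coe_mul_eq_smul,
    Quaternion.re_smul, smul_eq_mul, mul_smul_comm]
  module

/-- By invariance, the complex structure is determined by its values at the real points. -/
lemma complexStructure_mul (hinv : IsSU2Invariant (cylinder R) h J) {x : ℍ[ℝ]}
    (hx : x ∈ cylinder R) (a : ℍ[ℝ]) : J x (a * x) = J (‖x‖ : ℍ[ℝ]) a * x := by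
  have hn : ‖x‖ ≠ 0 := norm_ne_zero_iff.2 hx.1
  have hq : ‖‖x‖⁻¹ • x‖ = 1 := by rw [norm_smul, norm_inv, norm_norm, inv_mul_cancel₀ hn]
  have hmul : ∀ b : ℍ[ℝ], ((‖x‖ : ℝ) • b) * (‖x‖⁻¹ • x) = b * x := by
    intro b
    rw [smul_mul_smul_comm, mul_inv_cancel₀ hn, one_smul]
  have h1 := (hinv _ hq (‖x‖ : ℍ[ℝ]) (coe_mem_cylinder (mem_cylinder_iff.1 hx))
    ((‖x‖ : ℝ) • a) 0).2
  rw [hmul, map_smul, hmul, ← mul_one (‖x‖ : ℍ[ℝ]), Quaternion.coe_mul_eq_smul, hmul, one_mul] at h1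
  rw [h1, ← Quaternion.coe_mul_eq_smul, mul_one]

lemma imQ_commutator (y z : Fin 3 → ℝ) :
    imQ y * imQ z - imQ z * imQ y = imQ ((2 : ℝ) • (y ⨯₃ z)) := by
  ext <;> simp <;> ring

lemma planeJ_neg (M : Matrix (Fin 3) (Fin 3) ℝ) (y : Fin 3 → ℝ) : planeJ M (-y) = -planeJ M y := by
  simp only [planeJ, dotProduct_neg, neg_smul]
  abel

/-- Integrability of `J` determines its derivative in the radial direction, on the vectors `y` in
the plane of `X₀, X₁`. It is the vanishing of the Nijenhuis tensor on the fields `x` and `y * x`. -/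
lemma exists_hasDerivAt_complexStructure (hK : IsKahlerOn (cylinder R) h J)
    (hinv : IsSU2Invariant (cylinder R) h J) (hE : HasAdaptedCoframe R h J E)
    {ρ : ℝ} (hρ : ρ ∈ radii R) :
    ∃ J' : ℍ[ℝ] →L[ℝ] ℍ[ℝ], HasDerivAt (fun s : ℝ => J (s : ℍ[ℝ])) J' ρ ∧
      ∀ y, E ρ 2 ⬝ᵥ y = 0 → vec (J' (imQ y)) = dualVec (E ρ) 2 ⨯₃ y
        + planeJ (E ρ) (dualVec (E ρ) 2 ⨯₃ planeJ (E ρ) y) := by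
  have hx := coe_mem_cylinder hρ
  have h0 : ρ ≠ 0 := hρ.1.ne'
  have hJd := (differentiableAt_complexStructure hK hx).hasFDerivAt.comp_hasDerivAt
        ρ (hasDerivAt_coe ρ)
  refine ⟨_, hJd, fun y hy => ?_⟩
  set J' := fderiv ℝ J (ρ : ℍ[ℝ]) 1 with hJ'
  have hJ1 : ∀ b : ℍ[ℝ], HasDerivAt (fun s : ℝ => J (s : ℍ[ℝ]) b) (J' b) ρ := fun b => by
    simpa using hJd.clm_apply (hasDerivAt_const ρ b)
  have hnij := hK.integrable (fun x => x) (fun x => imQ y * x) contDiffOn_id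
    (contDiff_const.mul contDiff_id).contDiffOn _ hx
  have ev : ∀ a : ℍ[ℝ], (fun x : ℍ[ℝ] => J x (a * x)) =ᶠ[𝓝 (ρ : ℍ[ℝ])]
      fun x => (fun s : ℝ => J (s : ℍ[ℝ]) a) ‖x‖ * x := fun a => by
    filter_upwards [(isOpen_cylinder R).mem_nhds hx] with x hx'
    exact complexStructure_mul hinv hx' a
  have ev1 := ev 1
  simp only [one_mul] at ev1
  have hX : (fun x : ℍ[ℝ] => x) = fun x => (fun _ : ℝ => (1 : ℍ[ℝ])) ‖x‖ * x := by
    ext1 x; simp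
  have hY : (fun x : ℍ[ℝ] => imQ y * x) = fun x => (fun _ : ℝ => imQ y) ‖x‖ * x := rfl
  have b1 := lieBracket_orbitField hρ.1 (hJ1 1) (hJ1 (imQ y))
  have b2 := lieBracket_orbitField hρ.1 (hJ1 1) (hasDerivAt_const ρ (imQ y))
  have b3 := lieBracket_orbitField hρ.1 (hasDerivAt_const ρ (1 : ℍ[ℝ])) (hJ1 (imQ y))
  have b4 := lieBracket_orbitField hρ.1 (hasDerivAt_const ρ (1 : ℍ[ℝ]))
    (hasDerivAt_const ρ (imQ y))
  rw [← hX] at b3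
  rw [← hX, ← hY] at b4
  rw [← hY] at b2
  rw [nijenhuis, ev1.lieBracket_vectorField_eq (ev (imQ y)), b1,
    ev1.lieBracket_vectorField_eq (EventuallyEq.refl _ _), b2,
    (EventuallyEq.refl _ _).lieBracket_vectorField_eq (ev (imQ y)), b3, b4] at hnij
  have c1 : J (ρ : ℍ[ℝ]) 1 = imQ ((ρ / 2) • dualVec (E ρ) 2) := by
    rw [complexStructure_real hK hE hρ]
    have : vec (1 : ℍ[ℝ]) = 0 := by apply vec3_ext <;> simp
    simp [this, planeJ]
  have c2 : J (ρ : ℍ[ℝ]) (imQ y) = imQ (planeJ (E ρ) y) := by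
    rw [complexStructure_real hK hE hρ]
    simp [hy]
  have c3 : ∀ z z' : Fin 3 → ℝ, imQ z * imQ ((ρ / 2) • z') - imQ ((ρ / 2) • z') * imQ z
      = ρ • imQ (z ⨯₃ z') := by
    intro z z'
    rw [imQ_commutator]
    ext <;> simp <;> ring
  rw [c1, c2, c3, c3] at hnij
  simp only [re_imQ, zero_smul, smul_zero, sub_zero, zero_add, Quaternion.re_one, one_smul,
    mul_one, one_mul, sub_self, map_smul, ← smul_sub, smul_eq_zero, h0, false_or, add_zero] at hnij
  have h2 := congrArg (fun q => vec (J (ρ : ℍ[ℝ]) q)) hnij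
  simp only [map_sub, map_zero, hK.sq_neg _ hx] at h2
  have h3 : ∀ a b : ℍ[ℝ], vec (a - b) = vec a - vec b := vecL.map_sub
  have h4 : ∀ a : ℍ[ℝ], vec (-a) = -vec a := vecL.map_neg
  rw [h3, h3, h4, h4, vec_complexStructure_real hK hE hρ, vec_imQ, vec_imQ,
    show vec 0 = 0 from vecL.map_zero] at h2
  simp only [re_imQ, mul_zero, zero_smul, zero_add] at h2
  rw [← cross_anticomm y, ← cross_anticomm (planeJ (E ρ) y), planeJ_neg, ← sub_eq_zero,
    ← h2]
  abel

/-! ### Two gauge-invariant functions and their evolution -/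

/-- `2 |X₀ × X₁| / (|X₀|² + |X₁|²)` for the dual basis `X`, in terms of the cofactors
`cof M i = det(M) Xᵢ`. For `0 < det M` it lies in `(0, 1]`, and is `1` if and only if `X₀` and `X₁` are
orthogonal of equal length. It does not change when the first two rows of `M` are rotated. -/
def roundness (M : Matrix (Fin 3) (Fin 3) ℝ) : ℝ :=
  2 * M.det * Real.sqrt (M 2 ⬝ᵥ M 2) / (cof M 0 ⬝ᵥ cof M 0 + cof M 1 ⬝ᵥ cof M 1)

/-- `((w ⬝ X₀)² + (w ⬝ X₁)²) / (|X₀|² + |X₁|²)` for `w = M 0 × M 1` and the dual basis `X`. For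
`det M ≠ 0` it is `0` if and only if `w` is parallel to `M 2`. It does not change when the first two
rows of `M` are rotated. -/
def tilt (M : Matrix (Fin 3) (Fin 3) ℝ) : ℝ :=
  ((cof M 2 ⬝ᵥ cof M 0) ^ 2 + (cof M 2 ⬝ᵥ cof M 1) ^ 2)
    / (cof M 0 ⬝ᵥ cof M 0 + cof M 1 ⬝ᵥ cof M 1)

lemma dot_self_nonneg (y : Fin 3 → ℝ) : 0 ≤ y ⬝ᵥ y := by
  rw [dot3]; nlinarith [sq_nonneg (y 0), sq_nonneg (y 1), sq_nonneg (y 2)]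

lemma dot_self_pos {y : Fin 3 → ℝ} (hy : y ≠ 0) : 0 < y ⬝ᵥ y :=
  (dot_self_nonneg y).lt_of_ne fun h => hy (dotProduct_self_eq_zero.1 h.symm)

lemma cof_ne_zero {M : Matrix (Fin 3) (Fin 3) ℝ} (hM : M.det ≠ 0) (i : Fin 3) : cof M i ≠ 0 := by
  intro h
  have := row_dot_cof M i i
  rw [h] at this
  simp at this
  exact hM this.symm

lemma row_ne_zero {M : Matrix (Fin 3) (Fin 3) ℝ} (hM : M.det ≠ 0) (i : Fin 3) : M i ≠ 0 := by
  intro h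
  have := row_dot_cof M i i
  rw [h] at this
  simp at this
  exact hM this.symm

lemma lagrange_cof (M : Matrix (Fin 3) (Fin 3) ℝ) :
    (cof M 0 ⬝ᵥ cof M 0) * (cof M 1 ⬝ᵥ cof M 1) - (cof M 0 ⬝ᵥ cof M 1) ^ 2
      = M.det ^ 2 * (M 2 ⬝ᵥ M 2) := by
  have h1 : cof M 0 ⨯₃ cof M 1 = M.det • M 2 := by
    rw [Matrix.det_fin_three]
    apply vec3_ext <;> simp [cof_zero, cof_one] <;> ring
  have h2 := cross_dot_cross (cof M 0) (cof M 1) (cof M 0) (cof M 1)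
  rw [h1, smul_dotProduct, dotProduct_smul, smul_eq_mul, smul_eq_mul,
    dotProduct_comm (cof M 1) (cof M 0)] at h2
  linarith

lemma dualVec_dot (M : Matrix (Fin 3) (Fin 3) ℝ) (i j : Fin 3) :
    dualVec M i ⬝ᵥ dualVec M j = (M.det ^ 2)⁻¹ * (cof M i ⬝ᵥ cof M j) := by
  simp only [dualVec, smul_dotProduct, dotProduct_smul, smul_eq_mul]
  ring

lemma lagrange_dualVec {M : Matrix (Fin 3) (Fin 3) ℝ} (hM : M.det ≠ 0) :
    (dualVec M 0 ⬝ᵥ dualVec M 0) * (dualVec M 1 ⬝ᵥ dualVec M 1)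
      - (dualVec M 0 ⬝ᵥ dualVec M 1) ^ 2 = (M.det ^ 2)⁻¹ * (M 2 ⬝ᵥ M 2) := by
  have := lagrange_cof M
  simp only [dualVec_dot]
  field_simp
  linear_combination this

/-- `roundness` and `tilt` in terms of an arbitrary vector `p` in the plane of `X₀` and `X₁` and its
image `r` under the complex structure of that plane. -/
lemma roundness_tilt_eq {M : Matrix (Fin 3) (Fin 3) ℝ} (hM : 0 < M.det) {p r : Fin 3 → ℝ}
    {α β : ℝ} (hp : p = α • dualVec M 0 + β • dualVec M 1)
    (hr : r = α • dualVec M 1 - β • dualVec M 0) (h0 : 0 < α ^ 2 + β ^ 2) :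
    roundness M = 2 * Real.sqrt ((p ⬝ᵥ p) * (r ⬝ᵥ r) - (p ⬝ᵥ r) ^ 2) / (p ⬝ᵥ p + r ⬝ᵥ r) ∧
      tilt M = ((cof M 2 ⬝ᵥ p) ^ 2 + (cof M 2 ⬝ᵥ r) ^ 2) / (p ⬝ᵥ p + r ⬝ᵥ r) := by
  have hM0 := hM.ne'
  have hN : p ⬝ᵥ p + r ⬝ᵥ r
      = (α ^ 2 + β ^ 2) * ((M.det ^ 2)⁻¹ * (cof M 0 ⬝ᵥ cof M 0 + cof M 1 ⬝ᵥ cof M 1)) := by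
    rw [mul_add, ← dualVec_dot, ← dualVec_dot, hp, hr]
    simp only [dot3, Pi.add_apply, Pi.sub_apply, Pi.smul_apply, smul_eq_mul]
    ring
  have hD : (p ⬝ᵥ p) * (r ⬝ᵥ r) - (p ⬝ᵥ r) ^ 2
      = ((α ^ 2 + β ^ 2) * M.det⁻¹) ^ 2 * (M 2 ⬝ᵥ M 2) := by
    rw [mul_pow, inv_pow, mul_assoc, ← lagrange_dualVec hM0, hp, hr]
    simp only [dot3, Pi.add_apply, Pi.sub_apply, Pi.smul_apply, smul_eq_mul]
    ring
  have hW : (cof M 2 ⬝ᵥ p) ^ 2 + (cof M 2 ⬝ᵥ r) ^ 2 = (α ^ 2 + β ^ 2) * ((M.det ^ 2)⁻¹ *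
      ((cof M 2 ⬝ᵥ cof M 0) ^ 2 + (cof M 2 ⬝ᵥ cof M 1) ^ 2)) := by
    rw [hp, hr]
    simp only [dualVec, dotProduct_add, dotProduct_sub, dotProduct_smul, smul_eq_mul]
    ring
  have hc : 0 < cof M 0 ⬝ᵥ cof M 0 + cof M 1 ⬝ᵥ cof M 1 :=
    add_pos (dot_self_pos (cof_ne_zero hM0 0)) (dot_self_pos (cof_ne_zero hM0 1))
  have h0' := h0.ne'
  constructor
  · rw [hD, hN, Real.sqrt_mul (sq_nonneg _), Real.sqrt_sq (by positivity), roundness]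
    field_simp
  · rw [hW, hN, tilt]
    field_simp

/-- Near every radius there is a smooth vector field `p` in the plane spanned by `X₀` and `X₁`; its
derivative and the one of `r = J p` are determined by the integrability of `J`, up to a complex
multiple of `p - i r`. -/
lemma exists_planeField (hK : IsKahlerOn (cylinder R) h J)
    (hinv : IsSU2Invariant (cylinder R) h J) (hE : HasAdaptedCoframe R h J E)
    {ρ : ℝ} (hρ : ρ ∈ radii R) :
    ∃ (p r : ℝ → Fin 3 → ℝ) (l m : ℝ), p ρ = dualVec (E ρ) 0 ∧ r ρ = dualVec (E ρ) 1 ∧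
      HasDerivAt p (-(dualVec (E ρ) 2 ⨯₃ dualVec (E ρ) 1) + l • dualVec (E ρ) 0
        + m • dualVec (E ρ) 1) ρ ∧
      HasDerivAt r (dualVec (E ρ) 2 ⨯₃ dualVec (E ρ) 0 - m • dualVec (E ρ) 0
        + l • dualVec (E ρ) 1) ρ ∧
      ∀ᶠ s in 𝓝 ρ, ∃ α β : ℝ, 0 < α ^ 2 + β ^ 2 ∧
        p s = α • dualVec (E s) 0 + β • dualVec (E s) 1 ∧
        r s = α • dualVec (E s) 1 - β • dualVec (E s) 0 := by
  obtain ⟨J', hJ', hJv⟩ := exists_hasDerivAt_complexStructure hK hinv hE hρ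
  have hd : (E ρ).det ≠ 0 := (hE.oriented ρ hρ).ne'
  set X := dualVec (E ρ) with hX
  set r : ℝ → Fin 3 → ℝ := fun s => vec (J (s : ℍ[ℝ]) (imQ (X 0))) with hr
  set p : ℝ → Fin 3 → ℝ := fun s => -vec (J (s : ℍ[ℝ]) (imQ (r s))) with hp
  have hrs : ∀ s ∈ radii R, r s = (E s 0 ⬝ᵥ X 0) • dualVec (E s) 1
      - (E s 1 ⬝ᵥ X 0) • dualVec (E s) 0 := by
    intro s hs
    simp only [hr, vec_complexStructure_real hK hE hs, vec_imQ, re_imQ, mul_zero, zero_smul,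
      zero_add]
    rfl
  have hps : ∀ s ∈ radii R, p s = (E s 0 ⬝ᵥ X 0) • dualVec (E s) 0
      + (E s 1 ⬝ᵥ X 0) • dualVec (E s) 1 := by
    intro s hs
    have hd' : (E s).det ≠ 0 := (hE.oriented s hs).ne'
    simp only [hp, vec_complexStructure_real hK hE hs, vec_imQ, re_imQ, mul_zero, zero_smul,
      zero_add, hrs s hs, planeJ, dotProduct_sub, dotProduct_smul, row_dot_dualVec hd']
    simp
  have hr0 : r ρ = X 1 := by
    rw [hrs ρ hρ, hX, row_dot_dualVec hd, row_dot_dualVec hd]; simp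
  have hp0 : p ρ = X 0 := by
    rw [hps ρ hρ, hX, row_dot_dualVec hd, row_dot_dualVec hd]; simp
  have hv : ∀ i : Fin 3, i ≠ 2 → E ρ 2 ⬝ᵥ X i = 0 := fun i hi => by
    rw [hX, row_dot_dualVec hd, if_neg hi.symm]
  have hrd : HasDerivAt r (X 2 ⨯₃ X 0 + planeJ (E ρ) (X 2 ⨯₃ X 1)) ρ := by
    have h1 := vecL.hasFDerivAt.comp_hasDerivAt ρ (hJ'.clm_apply (hasDerivAt_const ρ (imQ (X 0))))
    refine h1.congr_deriv ?_
    rw [map_zero, add_zero, vecL_apply, hJv _ (hv 0 (by decide)), hX, planeJ_dualVec_zero hd]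
  have hpd : HasDerivAt p (-(X 2 ⨯₃ X 1) - planeJ (E ρ) (planeJ (E ρ) (X 2 ⨯₃ X 1))) ρ := by
    have h1 := (vecL.hasFDerivAt.comp_hasDerivAt ρ (hJ'.clm_apply
      (imQL.hasFDerivAt.comp_hasDerivAt ρ hrd))).neg
    refine h1.congr_deriv ?_
    have hadd : ∀ y z, planeJ (E ρ) (y + z) = planeJ (E ρ) y + planeJ (E ρ) z := fun y z => by
      simp only [planeJ, dotProduct_add, add_smul]; abel
    simp only [Function.comp, imQL_apply, vecL_apply, vec_add, hr0, hJv _ (hv 1 (by decide)),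
      vec_complexStructure_real hK hE hρ, vec_imQ, re_imQ, mul_zero, zero_smul, zero_add, hadd]
    rw [show planeJ (E ρ) (X 1) = -X 0 from planeJ_dualVec_one hd, map_neg, planeJ_neg]
    abel
  refine ⟨p, r, E ρ 0 ⬝ᵥ (X 2 ⨯₃ X 1), E ρ 1 ⬝ᵥ (X 2 ⨯₃ X 1), hp0, hr0, hpd.congr_deriv ?_,
    hrd.congr_deriv ?_, ?_⟩
  · have : planeJ (E ρ) (planeJ (E ρ) (X 2 ⨯₃ X 1)) = -((E ρ 0 ⬝ᵥ (X 2 ⨯₃ X 1)) • X 0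
        + (E ρ 1 ⬝ᵥ (X 2 ⨯₃ X 1)) • X 1) := by
      rw [planeJ]
      simp only [planeJ, dotProduct_sub, dotProduct_smul, row_dot_dualVec hd]
      simp [hX]
      abel
    rw [this]
    abel
  · rw [planeJ]
    abel
  · have hne : ∀ᶠ s in 𝓝 ρ, p s ≠ 0 := by
      refine hpd.continuousAt.eventually_ne ?_
      rw [hp0, hX, dualVec]
      exact smul_ne_zero (inv_ne_zero hd) (cof_ne_zero hd 0)
    filter_upwards [hne, eventually_mem_radii hρ] with s hs hs'
    refine ⟨_, _, ?_, hps s hs', hrs s hs'⟩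
    by_contra hcon
    have h0 : E s 0 ⬝ᵥ X 0 = 0 := by nlinarith [sq_nonneg (E s 0 ⬝ᵥ X 0), sq_nonneg (E s 1 ⬝ᵥ X 0)]
    have h1 : E s 1 ⬝ᵥ X 0 = 0 := by nlinarith [sq_nonneg (E s 0 ⬝ᵥ X 0), sq_nonneg (E s 1 ⬝ᵥ X 0)]
    exact hs (by rw [hps s hs', h0, h1]; simp)

/-- The evolution of `roundness` and `tilt`. The terms with the unknown multiple `l + i m` from
`exists_planeField` cancel. -/
lemma hasDerivAt_roundness_tilt (hK : IsKahlerOn (cylinder R) h J)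
    (hinv : IsSU2Invariant (cylinder R) h J) (hE : HasAdaptedCoframe R h J E)
    {ρ : ℝ} (hρ : ρ ∈ radii R) :
    HasDerivAt (fun s => roundness (E s))
      (2 / Real.sqrt (E ρ 2 ⬝ᵥ E ρ 2) * (1 - roundness (E ρ) ^ 2)) ρ ∧
    HasDerivAt (fun s => tilt (E s))
      (-(2 * roundness (E ρ) / Real.sqrt (E ρ 2 ⬝ᵥ E ρ 2)) * tilt (E ρ)) ρ := by
  obtain ⟨p, r, l, m, hp0, hr0, hp, hr, hev⟩ := exists_planeField hK hinv hE hρ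
  have hdp := hE.oriented ρ hρ
  have hd : (E ρ).det ≠ 0 := hdp.ne'
  have hw := hasDerivAt_cof_two hK hE hρ
  have hev' : ∀ᶠ s in 𝓝 ρ, roundness (E s) =
        2 * Real.sqrt ((p s ⬝ᵥ p s) * (r s ⬝ᵥ r s) - (p s ⬝ᵥ r s) ^ 2)
          / (p s ⬝ᵥ p s + r s ⬝ᵥ r s) ∧
      tilt (E s) = ((cof (E s) 2 ⬝ᵥ p s) ^ 2 + (cof (E s) 2 ⬝ᵥ r s) ^ 2)
          / (p s ⬝ᵥ p s + r s ⬝ᵥ r s) := by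
    filter_upwards [hev, eventually_mem_radii hρ] with s ⟨α, β, h0, h1, h2⟩ hs
    exact roundness_tilt_eq (hE.oriented s hs) h1 h2 h0
  obtain ⟨hround, htilt⟩ := hev'.self_of_nhds
  have hN := (hasDerivAt_dotProduct hp hp).add (hasDerivAt_dotProduct hr hr)
  have hD := ((hasDerivAt_dotProduct hp hp).mul (hasDerivAt_dotProduct hr hr)).sub
    ((hasDerivAt_dotProduct hp hr).pow 2)
  have hwp := hasDerivAt_dotProduct hw hp
  have hwr := hasDerivAt_dotProduct hw hr
  have hlag := lagrange_dualVec hd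
  have hvp : E ρ 2 ⬝ᵥ dualVec (E ρ) 0 = 0 := by rw [row_dot_dualVec hd]; simp
  have hvr : E ρ 2 ⬝ᵥ dualVec (E ρ) 1 = 0 := by rw [row_dot_dualVec hd]; simp
  have hwX : cof (E ρ) 2 = (E ρ).det • dualVec (E ρ) 2 := by
    rw [dualVec, smul_smul, mul_inv_cancel₀ hd, one_smul]
  have htri : dualVec (E ρ) 2 ⬝ᵥ (dualVec (E ρ) 0 ⨯₃ dualVec (E ρ) 1) = (E ρ).det⁻¹ := by
    have h1 : cof (E ρ) 0 ⨯₃ cof (E ρ) 1 = (E ρ).det • E ρ 2 := by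
      rw [Matrix.det_fin_three]
      apply vec3_ext <;> simp [cof_zero, cof_one] <;> ring
    have h2 : dualVec (E ρ) 2 ⬝ᵥ E ρ 2 = 1 := by
      rw [dotProduct_comm, row_dot_dualVec hd]; simp
    simp only [dualVec, map_smul, LinearMap.smul_apply, h1, smul_smul, dotProduct_smul] at h2 ⊢
    rw [h2]; simp [hd]
  have hvpos : 0 < E ρ 2 ⬝ᵥ E ρ 2 := dot_self_pos (row_ne_zero hd 2)
  generalize dualVec (E ρ) 0 = X at *
  generalize dualVec (E ρ) 1 = Y at *
  generalize dualVec (E ρ) 2 = Z at *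
  have e1 : X ⬝ᵥ (Z ⨯₃ Y) = -(E ρ).det⁻¹ := by rw [← htri]; simp [dot3]; ring
  have e2 : Y ⬝ᵥ (Z ⨯₃ X) = (E ρ).det⁻¹ := by rw [← htri]; simp [dot3]; ring
  have e3 : X ⬝ᵥ (Z ⨯₃ X) = 0 := by simp
  have e4 : Y ⬝ᵥ (Z ⨯₃ Y) = 0 := by simp
  have e5 : ∀ U, Z ⬝ᵥ (Z ⨯₃ U) = 0 := fun U => by simp
  have hPpos : 0 < X ⬝ᵥ X + Y ⬝ᵥ Y := by
    have := dot_self_nonneg X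
    have := dot_self_nonneg Y
    have : 0 < ((E ρ).det ^ 2)⁻¹ * (E ρ 2 ⬝ᵥ E ρ 2) := by positivity
    nlinarith [sq_nonneg (X ⬝ᵥ Y)]
  simp only [hp0, hr0, hwX, dotProduct_add, dotProduct_sub, dotProduct_neg, dotProduct_smul,
    add_dotProduct, sub_dotProduct, neg_dotProduct, smul_dotProduct, smul_eq_mul,
    dotProduct_comm (Z ⨯₃ _) _, e1, e2, e3, e4, e5, hvp, hvr, dotProduct_comm Y X]
    at hN hD hwp hwr hround htilt
  set δ := (E ρ).det with hδ
  set V := E ρ 2 ⬝ᵥ E ρ 2 with hV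
  set T := Real.sqrt V with hT
  have hTpos : 0 < T := Real.sqrt_pos.2 hvpos
  have hTT : T ^ 2 = V := Real.sq_sqrt hvpos.le
  rw [← hTT] at hlag
  set P := X ⬝ᵥ X with hP
  set Q := Y ⬝ᵥ Y with hQ
  set S := X ⬝ᵥ Y with hS
  have hsq : Real.sqrt (P * Q - S ^ 2) = T / δ := by
    rw [hlag, ← inv_pow, ← mul_pow, Real.sqrt_sq (by positivity)]
    field_simp
  have hT2 : T ^ 2 = δ ^ 2 * (P * Q - S ^ 2) := by rw [hlag]; field_simp
  rw [hsq] at hround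
  have hNne : P + Q ≠ 0 := hPpos.ne'
  constructor
  · have hDpos : P * Q - S ^ 2 ≠ 0 := by rw [hlag]; positivity
    have h1 := ((hD.sqrt (by simpa [hp0, hr0] using hDpos)).const_mul 2).div hN
      (by simpa [hp0, hr0] using hNne)
    refine (h1.congr_of_eventuallyEq ?_).congr_deriv ?_
    · filter_upwards [hev'] with s hs using hs.1
    · rw [hround]
      simp only [Pi.sub_apply, Pi.mul_apply, Pi.pow_apply, Pi.add_apply, hp0, hr0, ← hP, ← hQ,
        ← hS, hsq]
      field_simp
      rw [hT2]
      push_cast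
      ring
  · have h1 := ((hwp.pow 2).add (hwr.pow 2)).div hN (by simpa [hp0, hr0] using hNne)
    refine (h1.congr_of_eventuallyEq ?_).congr_deriv ?_
    · filter_upwards [hev'] with s hs using hs.2
    · rw [hround, htilt]
      simp only [Pi.pow_apply, Pi.add_apply, hp0, hr0, ← hP, ← hQ, hwX,
        smul_dotProduct, smul_eq_mul]
      field_simp
      ring

/-! ### Rigidity from slow growth of the third row at `ρ = 0` -/

lemma sum_cof_pos {M : Matrix (Fin 3) (Fin 3) ℝ} (hM : M.det ≠ 0) :
    0 < cof M 0 ⬝ᵥ cof M 0 + cof M 1 ⬝ᵥ cof M 1 :=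
  add_pos (dot_self_pos (cof_ne_zero hM 0)) (dot_self_pos (cof_ne_zero hM 1))

lemma roundness_pos {M : Matrix (Fin 3) (Fin 3) ℝ} (hM : 0 < M.det) : 0 < roundness M := by
  have := Real.sqrt_pos.2 (dot_self_pos (row_ne_zero hM.ne' 2))
  exact div_pos (by positivity) (sum_cof_pos hM.ne')

lemma roundness_le_one {M : Matrix (Fin 3) (Fin 3) ℝ} (hM : 0 < M.det) : roundness M ≤ 1 := by
  rw [roundness, div_le_one (sum_cof_pos hM.ne')]
  have h1 := Real.sq_sqrt (dot_self_nonneg (M 2))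
  have h2 := lagrange_cof M
  refine abs_le_of_sq_le_sq' ?_ (sum_cof_pos hM.ne').le |>.2
  rw [mul_pow, h1]
  nlinarith [sq_nonneg (cof M 0 ⬝ᵥ cof M 1),
    sq_nonneg (cof M 0 ⬝ᵥ cof M 0 - cof M 1 ⬝ᵥ cof M 1)]

lemma tilt_nonneg (M : Matrix (Fin 3) (Fin 3) ℝ) : 0 ≤ tilt M :=
  div_nonneg (by positivity) (add_nonneg (dot_self_nonneg _) (dot_self_nonneg _))

lemma sq_dot_le (y z : Fin 3 → ℝ) : (y ⬝ᵥ z) ^ 2 ≤ (y ⬝ᵥ y) * (z ⬝ᵥ z) := by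
  have h1 := cross_dot_cross y z y z
  have h2 := dot_self_nonneg (y ⨯₃ z)
  rw [dotProduct_comm z y] at h1
  nlinarith

lemma tilt_le {M : Matrix (Fin 3) (Fin 3) ℝ} (hM : M.det ≠ 0) : tilt M ≤ cof M 2 ⬝ᵥ cof M 2 := by
  rw [tilt, div_le_iff₀ (sum_cof_pos hM), mul_add]
  exact add_le_add (sq_dot_le _ _) (sq_dot_le _ _)

lemma monotoneOn_of_hasDerivAt_nonneg {f f' : ℝ → ℝ} {s : Set ℝ} (hs : Convex ℝ s)
    (hf : ∀ x ∈ s, HasDerivAt f (f' x) x) (hf' : ∀ x ∈ s, 0 ≤ f' x) : MonotoneOn f s :=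
  monotoneOn_of_deriv_nonneg hs (fun x hx => (hf x hx).continuousAt.continuousWithinAt)
    (fun x hx => (hf x (interior_subset hx)).differentiableAt.differentiableWithinAt)
    fun x hx => by rw [(hf x (interior_subset hx)).deriv]; exact hf' x (interior_subset hx)

/-- Since `1 / (ρ log (1 / ρ))` is not integrable at `0`, no function that is bounded below grows
at least at this rate. -/
lemma not_bddBelow_of_deriv_ge {f f' : ℝ → ℝ} {ρ₁ c B : ℝ} (h0 : 0 < ρ₁) (h1 : ρ₁ < 1) (hc : 0 < c)
    (hf : ∀ ρ ∈ Set.Ioo 0 ρ₁, HasDerivAt f (f' ρ) ρ)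
    (hf' : ∀ ρ ∈ Set.Ioo 0 ρ₁, c / (ρ * -Real.log ρ) ≤ f' ρ)
    (hB : ∀ ρ ∈ Set.Ioo 0 ρ₁, B ≤ f ρ) : False := by
  have hlog : ∀ ρ ∈ Set.Ioo 0 ρ₁, 0 < -Real.log ρ := fun ρ hρ =>
    neg_pos.2 (Real.log_neg hρ.1 (hρ.2.trans h1))
  have hmono : MonotoneOn (fun ρ => f ρ + c * Real.log (-Real.log ρ)) (Set.Ioo 0 ρ₁) := by
    refine monotoneOn_of_hasDerivAt_nonneg (f' := fun ρ => f' ρ + c * (-ρ⁻¹ / -Real.log ρ))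
      (convex_Ioo 0 ρ₁) (fun ρ hρ => (hf ρ hρ).add
        (((Real.hasDerivAt_log hρ.1.ne').neg.log (hlog ρ hρ).ne').const_mul c)) fun ρ hρ => ?_
    have h2 := hf' ρ hρ
    have h3 : c * (-ρ⁻¹ / -Real.log ρ) = -(c / (ρ * -Real.log ρ)) := by
      rw [neg_div, div_eq_mul_inv, div_eq_mul_inv, mul_inv]; ring
    rw [h3]; linarith
  have hmid : ρ₁ / 2 ∈ Set.Ioo 0 ρ₁ := ⟨by linarith, by linarith⟩
  have htend : Tendsto (fun ρ => c * Real.log (-Real.log ρ)) (𝓝[>] 0) atTop :=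
    (Real.tendsto_log_atTop.comp (tendsto_neg_atBot_atTop.comp
      Real.tendsto_log_nhdsGT_zero)).const_mul_atTop hc
  have hsmall : ∀ᶠ ρ in 𝓝[>] (0 : ℝ), ρ ∈ Set.Ioo 0 (ρ₁ / 2) :=
    Ioo_mem_nhdsGT (by linarith)
  obtain ⟨ρ, hρ, hlarge⟩ := (hsmall.and (htend.eventually_gt_atTop
    (f (ρ₁ / 2) + c * Real.log (-Real.log (ρ₁ / 2)) - B))).exists
  have hρ' : ρ ∈ Set.Ioo 0 ρ₁ := ⟨hρ.1, by linarith [hρ.2]⟩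
  have h2 := hmono hρ' hmid hρ.2.le
  have h3 := hB ρ hρ'
  simp only at h2
  linarith

/-- The boundary condition that enters the rigidity argument: `|E₂| = O(ρ log (1 / ρ))` at
`ρ = 0`. -/
def SlowAtZero (E : ℝ → Matrix (Fin 3) (Fin 3) ℝ) : Prop :=
  ∃ C ρ₁ : ℝ, 0 < ρ₁ ∧ ρ₁ < 1 ∧
    ∀ ρ ∈ Set.Ioo 0 ρ₁, Real.sqrt (E ρ 2 ⬝ᵥ E ρ 2) ≤ C * (ρ * -Real.log ρ)

/-- If a function that is bounded below grows at a rate `c / |E₂|` near `ρ = 0`, then `c` is not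
positive, because the integral of `1 / |E₂|` diverges. -/
lemma SlowAtZero.rigid (hslow : SlowAtZero E) (hE : HasAdaptedCoframe R h J E) {f f' : ℝ → ℝ}
    {ρ₂ c B : ℝ} (h2 : ρ₂ ∈ radii R) (hc : 0 < c)
    (hf : ∀ ρ ∈ radii R, HasDerivAt f (f' ρ) ρ)
    (hf' : ∀ ρ ∈ radii R, ρ ≤ ρ₂ → c / Real.sqrt (E ρ 2 ⬝ᵥ E ρ 2) ≤ f' ρ)
    (hB : ∀ ρ ∈ radii R, ρ ≤ ρ₂ → B ≤ f ρ) : False := by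
  obtain ⟨C, ρ₁, h0, h1, hv⟩ := hslow
  have hmem : ∀ ρ ∈ Set.Ioo 0 (min ρ₁ ρ₂), ρ ∈ radii R ∧ ρ ≤ ρ₂ ∧ ρ ∈ Set.Ioo 0 ρ₁ :=
    fun ρ hρ => ⟨mem_radii_of_le h2 hρ.1 (hρ.2.le.trans (min_le_right _ _)),
      hρ.2.le.trans (min_le_right _ _), hρ.1, hρ.2.trans_le (min_le_left _ _)⟩
  have hlog : ∀ ρ ∈ Set.Ioo 0 ρ₁, 0 < ρ * -Real.log ρ := fun ρ hρ =>
    mul_pos hρ.1 (neg_pos.2 (Real.log_neg hρ.1 (hρ.2.trans h1)))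
  have hvpos : ∀ ρ ∈ radii R, 0 < Real.sqrt (E ρ 2 ⬝ᵥ E ρ 2) := fun ρ hρ =>
    Real.sqrt_pos.2 (dot_self_pos (row_ne_zero (hE.oriented ρ hρ).ne' 2))
  have hm : 0 < min ρ₁ ρ₂ := lt_min h0 h2.1
  have hC : 0 < C := by
    have hx : min ρ₁ ρ₂ / 2 ∈ Set.Ioo 0 (min ρ₁ ρ₂) := ⟨by linarith, by linarith⟩
    obtain ⟨a, -, b⟩ := hmem _ hx
    exact pos_of_mul_pos_left ((hvpos _ a).trans_le (hv _ b)) (hlog _ b).le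
  refine not_bddBelow_of_deriv_ge hm ((min_le_left _ _).trans_lt h1) (div_pos hc hC)
    (fun ρ hρ => hf ρ (hmem ρ hρ).1) (fun ρ hρ => ?_)
    (fun ρ hρ => hB ρ (hmem ρ hρ).1 (hmem ρ hρ).2.1)
  obtain ⟨a, b, d⟩ := hmem ρ hρ
  refine le_trans ?_ (hf' ρ a b)
  rw [div_div]
  exact div_le_div_of_nonneg_left hc.le (hvpos ρ a) (hv ρ d)

lemma convex_radii (R : ℝ≥0∞) : Convex ℝ (radii R) := (ordConnected_radii R).convex

/-- Otherwise `roundness` would decrease to `-∞` as `ρ → 0`. -/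
lemma roundness_eq_one (hK : IsKahlerOn (cylinder R) h J)
    (hinv : IsSU2Invariant (cylinder R) h J) (hE : HasAdaptedCoframe R h J E)
    (hslow : SlowAtZero E) {ρ : ℝ} (hρ : ρ ∈ radii R) : roundness (E ρ) = 1 := by
  by_contra hne
  have hlt := lt_of_le_of_ne (roundness_le_one (hE.oriented ρ hρ)) hne
  have hder := fun s hs => (hasDerivAt_roundness_tilt hK hinv hE (ρ := s) hs).1
  have hmono : MonotoneOn (fun s => roundness (E s)) (radii R) := by
    refine monotoneOn_of_hasDerivAt_nonneg (convex_radii R) hder fun s hs => ?_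
    have a := roundness_pos (hE.oriented s hs)
    have b := roundness_le_one (hE.oriented s hs)
    exact mul_nonneg (by positivity) (by nlinarith)
  have hpos := roundness_pos (hE.oriented ρ hρ)
  refine hslow.rigid hE hρ (c := 2 * (1 - roundness (E ρ) ^ 2)) (B := 0) (by nlinarith) hder
    (fun s hs hle => ?_) fun s hs _ => (roundness_pos (hE.oriented s hs)).le
  have a := roundness_pos (hE.oriented s hs)
  have b : roundness (E s) ≤ roundness (E ρ) := hmono hs hρ hle
  rw [mul_div_right_comm]
  exact mul_le_mul_of_nonneg_left (by nlinarith) (by positivity)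

/-- For `w = E₀ × E₁`, the derivative of `|w|²` is `2 w ⬝ E₂ = 2 det E > 0`. -/
lemma monotoneOn_sq_cof (hK : IsKahlerOn (cylinder R) h J) (hE : HasAdaptedCoframe R h J E) :
    MonotoneOn (fun s => cof (E s) 2 ⬝ᵥ cof (E s) 2) (radii R) := by
  refine monotoneOn_of_hasDerivAt_nonneg (convex_radii R)
    (fun s hs => hasDerivAt_dotProduct (hasDerivAt_cof_two hK hE hs)
      (hasDerivAt_cof_two hK hE hs)) fun s hs => ?_
  rw [dotProduct_comm (cof (E s) 2), row_dot_cof, if_pos rfl]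
  linarith [hE.oriented s hs]

/-- Otherwise `tilt` would grow to `∞` as `ρ → 0`, although it is bounded by the increasing function
`|w|²`. -/
lemma tilt_eq_zero (hK : IsKahlerOn (cylinder R) h J)
    (hinv : IsSU2Invariant (cylinder R) h J) (hE : HasAdaptedCoframe R h J E)
    (hslow : SlowAtZero E) {ρ : ℝ} (hρ : ρ ∈ radii R) : tilt (E ρ) = 0 := by
  by_contra hne
  have hlt := lt_of_le_of_ne (tilt_nonneg (E ρ)) (Ne.symm hne)
  have hder : ∀ s ∈ radii R, HasDerivAt (fun s => -tilt (E s))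
      (2 / Real.sqrt (E s 2 ⬝ᵥ E s 2) * tilt (E s)) s := fun s hs => by
    refine (hasDerivAt_roundness_tilt hK hinv hE hs).2.neg.congr_deriv ?_
    rw [roundness_eq_one hK hinv hE hslow hs]
    ring
  have hmono : MonotoneOn (fun s => -tilt (E s)) (radii R) :=
    monotoneOn_of_hasDerivAt_nonneg (convex_radii R) hder fun s hs =>
      mul_nonneg (by positivity) (tilt_nonneg _)
  have hw := monotoneOn_sq_cof hK hE
  refine hslow.rigid hE hρ (c := 2 * tilt (E ρ)) (B := -(cof (E ρ) 2 ⬝ᵥ cof (E ρ) 2))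
    (by positivity) hder (fun s hs hle => ?_) fun s hs hle => ?_
  · have b : tilt (E ρ) ≤ tilt (E s) := neg_le_neg_iff.1 (hmono hs hρ hle)
    rw [mul_div_right_comm]
    exact mul_le_mul_of_nonneg_left b (by positivity)
  · exact neg_le_neg ((tilt_le (hE.oriented s hs).ne').trans (hw hs hρ hle))

/-! ### The symmetry axis -/

/-- The direction of the cofactor vector `M 0 × M 1`. -/
def axis (M : Matrix (Fin 3) (Fin 3) ℝ) : Fin 3 → ℝ :=
  (Real.sqrt (cof M 2 ⬝ᵥ cof M 2))⁻¹ • cof M 2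

lemma dualVec_dot_of_round {M : Matrix (Fin 3) (Fin 3) ℝ} (hM : 0 < M.det)
    (h1 : roundness M = 1) (h2 : tilt M = 0) :
    dualVec M 0 ⬝ᵥ dualVec M 1 = 0 ∧ dualVec M 1 ⬝ᵥ dualVec M 1 = dualVec M 0 ⬝ᵥ dualVec M 0 ∧
      dualVec M 2 ⬝ᵥ dualVec M 0 = 0 ∧ dualVec M 2 ⬝ᵥ dualVec M 1 = 0 := by
  have hN := sum_cof_pos hM.ne'
  rw [roundness, div_eq_one_iff_eq hN.ne'] at h1
  rw [tilt, div_eq_zero_iff, or_iff_left hN.ne'] at h2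
  have hs := Real.sq_sqrt (dot_self_nonneg (M 2))
  have hlag := lagrange_cof M
  have key : (cof M 0 ⬝ᵥ cof M 0 - cof M 1 ⬝ᵥ cof M 1) ^ 2 + 4 * (cof M 0 ⬝ᵥ cof M 1) ^ 2 = 0 := by
    have : (2 * M.det * Real.sqrt (M 2 ⬝ᵥ M 2)) ^ 2
      = (cof M 0 ⬝ᵥ cof M 0 + cof M 1 ⬝ᵥ cof M 1) ^ 2 := by rw [h1]
    rw [mul_pow, hs] at this
    linarith
  have a1 : cof M 0 ⬝ᵥ cof M 1 = 0 := by
    nlinarith [sq_nonneg (cof M 0 ⬝ᵥ cof M 0 - cof M 1 ⬝ᵥ cof M 1), sq_nonneg (cof M 0 ⬝ᵥ cof M 1)]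
  have a2 : cof M 0 ⬝ᵥ cof M 0 - cof M 1 ⬝ᵥ cof M 1 = 0 := by
    nlinarith [sq_nonneg (cof M 0 ⬝ᵥ cof M 0 - cof M 1 ⬝ᵥ cof M 1), sq_nonneg (cof M 0 ⬝ᵥ cof M 1)]
  have a3 : cof M 2 ⬝ᵥ cof M 0 = 0 := by
    nlinarith [sq_nonneg (cof M 2 ⬝ᵥ cof M 0), sq_nonneg (cof M 2 ⬝ᵥ cof M 1)]
  have a4 : cof M 2 ⬝ᵥ cof M 1 = 0 := by
    nlinarith [sq_nonneg (cof M 2 ⬝ᵥ cof M 0), sq_nonneg (cof M 2 ⬝ᵥ cof M 1)]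
  simp only [dualVec_dot, a1, a3, a4, sub_eq_zero.1 a2]
  simp

/-- If `roundness` and `tilt` take their extremal values, then `M` is determined by its axis and
four numbers, up to rotations of its first two rows. -/
lemma exists_coeff_of_round {M : Matrix (Fin 3) (Fin 3) ℝ} (hM : 0 < M.det)
    (h1 : roundness M = 1) (h2 : tilt M = 0) :
    ∃ α β γ κ : ℝ, M 2 = γ • axis M ∧ cof M 2 = κ • axis M ∧
      ∀ y z, ∑ i, (M i ⬝ᵥ y) * (M i ⬝ᵥ z)
        = α * (y ⬝ᵥ z) + β * ((axis M ⬝ᵥ y) * (axis M ⬝ᵥ z)) := by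
  have hM0 := hM.ne'
  obtain ⟨a1, a2, a3, a4⟩ := dualVec_dot_of_round hM h1 h2
  have hXne : ∀ i, dualVec M i ≠ 0 := fun i => smul_ne_zero (inv_ne_zero hM0) (cof_ne_zero hM0 i)
  have hp := dot_self_pos (hXne 0)
  have hq := dot_self_pos (hXne 2)
  have hw := Real.sqrt_pos.2 (dot_self_pos (cof_ne_zero hM0 2))
  set X := dualVec M with hX
  have hcof : cof M 2 = Real.sqrt (cof M 2 ⬝ᵥ cof M 2) • axis M := by
    rw [axis, smul_smul, mul_inv_cancel₀ hw.ne', one_smul]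
  -- The dual basis is orthogonal, and its first two vectors have the same length.
  have hdot : ∀ y z, y ⬝ᵥ z = (X 0 ⬝ᵥ X 0) * ((M 0 ⬝ᵥ y) * (M 0 ⬝ᵥ z) + (M 1 ⬝ᵥ y) * (M 1 ⬝ᵥ z))
      + (X 2 ⬝ᵥ X 2) * ((M 2 ⬝ᵥ y) * (M 2 ⬝ᵥ z)) := by
    intro y z
    conv_lhs => rw [sum_dualVec hM0 y, sum_dualVec hM0 z]
    simp only [← hX, dotProduct_add, add_dotProduct, smul_dotProduct, dotProduct_smul, smul_eq_mul,
      a1, a2, a3, a4, dotProduct_comm (X 1) (X 0), dotProduct_comm (X 0) (X 2),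
      dotProduct_comm (X 1) (X 2)]
    ring
  have hX2 : X 2 = (X 2 ⬝ᵥ X 2) • M 2 := by
    have : ∀ z, X 2 ⬝ᵥ z = ((X 2 ⬝ᵥ X 2) • M 2) ⬝ᵥ z := fun z => by
      rw [hdot (X 2) z, hX, row_dot_dualVec hM0, row_dot_dualVec hM0, row_dot_dualVec hM0]
      simp
    exact dotProduct_eq _ _ this
  have hM2 : M 2 = ((X 2 ⬝ᵥ X 2)⁻¹ * (M.det⁻¹ * Real.sqrt (cof M 2 ⬝ᵥ cof M 2))) • axis M := by
    rw [← smul_smul, ← smul_smul, ← hcof]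
    change M 2 = (X 2 ⬝ᵥ X 2)⁻¹ • X 2
    conv_rhs => rw [hX2, smul_smul]
    rw [← hX2, inv_mul_cancel₀ hq.ne', one_smul]
  set γ := (X 2 ⬝ᵥ X 2)⁻¹ * (M.det⁻¹ * Real.sqrt (cof M 2 ⬝ᵥ cof M 2))
  refine ⟨(X 0 ⬝ᵥ X 0)⁻¹, (1 - (X 0 ⬝ᵥ X 0)⁻¹ * (X 2 ⬝ᵥ X 2)) * (γ * γ), γ, _, hM2, hcof,
    fun y z => ?_⟩
  have e : ∀ u, M 2 ⬝ᵥ u = γ * (axis M ⬝ᵥ u) := fun u => by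
    conv_lhs => rw [hM2]
    rw [smul_dotProduct]; rfl
  rw [hdot y z, Fin.sum_univ_three, mul_add, ← mul_assoc (X 0 ⬝ᵥ X 0)⁻¹,
    inv_mul_cancel₀ hp.ne', e, e]
  ring

lemma axis_dot_self {M : Matrix (Fin 3) (Fin 3) ℝ} (hM : M.det ≠ 0) : axis M ⬝ᵥ axis M = 1 := by
  have h1 := dot_self_pos (cof_ne_zero hM 2)
  have h2 := Real.sq_sqrt h1.le
  have h3 := (Real.sqrt_pos.2 h1).ne'
  rw [axis, smul_dotProduct, dotProduct_smul, smul_eq_mul, smul_eq_mul]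
  field_simp
  exact h2.symm

/-- The derivative `E₂` of `E₀ × E₁` is parallel to `E₀ × E₁`, so the direction does not change. -/
lemma axis_const (hK : IsKahlerOn (cylinder R) h J) (hE : HasAdaptedCoframe R h J E)
    (hround : ∀ ρ ∈ radii R, roundness (E ρ) = 1 ∧ tilt (E ρ) = 0) {ρ ρ' : ℝ}
    (hρ : ρ ∈ radii R) (hρ' : ρ' ∈ radii R) : axis (E ρ) = axis (E ρ') := by
  have hder : ∀ s ∈ radii R, HasDerivAt (fun s => axis (E s)) 0 s := by
    intro s hs
    have hd := hE.oriented s hs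
    obtain ⟨α, β, γ, κ, hv, hw, -⟩ := exists_coeff_of_round hd (hround s hs).1 (hround s hs).2
    have hwpos := dot_self_pos (cof_ne_zero hd.ne' 2)
    have hsq := Real.sq_sqrt hwpos.le
    have hspos := Real.sqrt_pos.2 hwpos
    have h1 := hasDerivAt_cof_two hK hE hs
    have h2 := (((hasDerivAt_dotProduct h1 h1).sqrt hwpos.ne').inv hspos.ne').smul h1
    refine h2.congr_deriv ?_
    have hn := axis_dot_self hd.ne'
    have hww : cof (E s) 2 ⬝ᵥ cof (E s) 2 = κ * κ := by
      rw [hw, smul_dotProduct, dotProduct_smul, hn]; simp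
    have hvw : E s 2 ⬝ᵥ cof (E s) 2 = γ * κ := by
      rw [hw, hv, smul_dotProduct, dotProduct_smul, hn]; simp
    simp only [Pi.inv_apply]
    rw [dotProduct_comm (cof (E s) 2) (E s 2), hvw]
    generalize Real.sqrt (cof (E s) 2 ⬝ᵥ cof (E s) 2) = q at *
    rw [hw, hv, smul_smul, smul_smul, ← add_smul]
    convert zero_smul ℝ (axis (E s)) using 2
    rw [hww] at hsq
    field_simp
    linear_combination 2 * γ * hsq
  have := (isOpen_radii R).is_const_of_deriv_eq_zero (convex_radii R).isPreconnected
    (fun s hs => (hder s hs).differentiableAt.differentiableWithinAt)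
    (fun s hs => (hder s hs).deriv) hρ hρ'
  exact this

/-! ### Invariance under rotations about the axis -/

lemma quaternion_re_mul_comm (a b : ℍ[ℝ]) : (a * b).re = (b * a).re := by simp; ring

lemma vec_dot_vec (a b : ℍ[ℝ]) : vec a ⬝ᵥ vec b = (a * star b).re - a.re * b.re := by
  simp [dot3]; ring

lemma dot_vec (n : Fin 3 → ℝ) (a : ℍ[ℝ]) : n ⬝ᵥ vec a = -(imQ n * a).re := by
  simp [dot3]; ring

lemma dot_cross_vec (n : Fin 3 → ℝ) (a b : ℍ[ℝ]) : n ⬝ᵥ (vec a ⨯₃ vec b)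
    = -(imQ n * (a * b)).re - a.re * (n ⬝ᵥ vec b) - b.re * (n ⬝ᵥ vec a) := by
  simp [dot3]; ring

section Rotation

variable {g : ℍ[ℝ]} (hg : star g * g = 1)
include hg

lemma re_conj (a : ℍ[ℝ]) : (g * a * star g).re = a.re := by
  rw [quaternion_re_mul_comm, ← mul_assoc, hg, one_mul]

lemma vec_dot_vec_conj (a b : ℍ[ℝ]) :
    vec (g * a * star g) ⬝ᵥ vec (g * b * star g) = vec a ⬝ᵥ vec b := by
  rw [vec_dot_vec, vec_dot_vec, re_conj hg, re_conj hg, ← re_conj hg (a * star b)]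
  congr 2
  rw [star_mul, star_mul, star_star]
  calc g * a * star g * (g * (star b * star g)) = g * a * (star g * g) * star b * star g := by
        noncomm_ring
    _ = g * (a * star b) * star g := by rw [hg]; noncomm_ring

lemma dot_vec_conj {n : Fin 3 → ℝ} (hn : imQ n * g = g * imQ n) (a : ℍ[ℝ]) :
    n ⬝ᵥ vec (g * a * star g) = n ⬝ᵥ vec a := by
  rw [dot_vec, dot_vec, ← mul_assoc, ← mul_assoc, hn, mul_assoc g, re_conj hg]

lemma dot_cross_vec_conj {n : Fin 3 → ℝ} (hn : imQ n * g = g * imQ n) (a b : ℍ[ℝ]) :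
    n ⬝ᵥ (vec (g * a * star g) ⨯₃ vec (g * b * star g)) = n ⬝ᵥ (vec a ⨯₃ vec b) := by
  rw [dot_cross_vec, dot_cross_vec, re_conj hg, re_conj hg, dot_vec_conj hg hn,
    dot_vec_conj hg hn, ← re_conj hg (imQ n * (a * b))]
  congr 4
  calc imQ n * (g * a * star g * (g * b * star g))
      = imQ n * g * a * (star g * g) * b * star g := by noncomm_ring
    _ = g * (imQ n * (a * b)) * star g := by rw [hg, hn]; noncomm_ring

end Rotation

/-- The circle consists of the unit quaternions that commute with the axis. Left multiplication by
such a `g` maps `a * x` to `(g * a * star g) * (g * x)`, and conjugation by `g` is a rotation of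
`ℝ³` that fixes the axis, so it preserves the coefficients of `h` and `Ω`. -/
lemma hasU1SU2Symmetry_of_round (hR : 0 < R) (hK : IsKahlerOn (cylinder R) h J)
    (hinv : IsSU2Invariant (cylinder R) h J) (hE : HasAdaptedCoframe R h J E)
    (hround : ∀ ρ ∈ radii R, roundness (E ρ) = 1 ∧ tilt (E ρ) = 0) :
    HasU1SU2Symmetry R h J := by
  refine ⟨hinv, ?_⟩
  obtain ⟨ρ₀, h0, hlt⟩ := ENNReal.lt_iff_exists_nnreal_btwn.1 hR
  have hρ₀ : (ρ₀ : ℝ) ∈ radii R := ⟨by exact_mod_cast h0, by simpa using hlt⟩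
  set n := axis (E ρ₀) with hn
  have hnn : n ⬝ᵥ n = 1 := axis_dot_self (hE.oriented _ hρ₀).ne'
  refine ⟨imQ n, rfl, ?_, ?_⟩
  · have h1 : ‖imQ n‖ * ‖imQ n‖ = 1 := by
      rw [dot3] at hnn
      rw [← Quaternion.normSq_eq_norm_mul_self, Quaternion.normSq_def']
      simp only [re_imQ, imI_imQ, imJ_imQ, imK_imQ]
      linear_combination hnn
    nlinarith [norm_nonneg (imQ n)]
  intro θ g hgdef
  have hg : star g * g = 1 := by
    have h1 : Quaternion.normSq g = 1 := by
      rw [dot3] at hnn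
      rw [Quaternion.normSq_def', hgdef]
      simp
      linear_combination Real.cos_sq_add_sin_sq θ + Real.sin θ ^ 2 * hnn
    rw [Quaternion.star_mul_self, h1, Quaternion.coe_one]
  have hgn : imQ n * g = g * imQ n := by
    rw [hgdef, mul_add, add_mul, Quaternion.coe_commutes]
    simp
  have hgnorm : ∀ x : ℍ[ℝ], ‖g * x‖ = ‖x‖ := fun x => by
    have h1 : ‖g‖ * ‖g‖ = 1 := by
      have := congrArg norm hg
      rwa [norm_mul, norm_star, norm_one] at this
    have h2 : ‖g‖ = 1 := by nlinarith [norm_nonneg g]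
    rw [norm_mul, h2, one_mul]
  have hmem : ∀ x ∈ cylinder R, g * x ∈ cylinder R := fun x hx => by
    rw [mem_cylinder_iff, hgnorm]; exact mem_cylinder_iff.1 hx
  have hconj : ∀ x ∈ cylinder R, ∀ v : ℍ[ℝ], g * v = (g * (v * x⁻¹) * star g) * (g * x) := by
    intro x hx v
    calc g * v = g * (v * (x⁻¹ * x)) := by rw [inv_mul_cancel₀ hx.1, mul_one]
      _ = g * (v * x⁻¹) * (star g * g) * x := by rw [hg]; noncomm_ring
      _ = _ := by noncomm_ring
  have hback : ∀ x ∈ cylinder R, ∀ v : ℍ[ℝ], v = (v * x⁻¹) * x := fun x hx v => by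
    rw [mul_assoc, inv_mul_cancel₀ hx.1, mul_one]
  have hmet : ∀ x ∈ cylinder R, ∀ v w, h (g * x) (g * v) (g * w) = h x v w := by
    intro x hx v w
    have hρ := mem_cylinder_iff.1 hx
    obtain ⟨α, β, γ, κ, -, -, hsum⟩ :=
      exists_coeff_of_round (hE.oriented _ hρ) (hround _ hρ).1 (hround _ hρ).2
    rw [hconj x hx v, hconj x hx w, metric_mul hE (hmem x hx), hgnorm]
    conv_rhs => rw [hback x hx v, hback x hx w, metric_mul hE hx]
    rw [hsum, hsum, axis_const hK hE hround hρ hρ₀, ← hn, re_conj hg, re_conj hg,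
      vec_dot_vec_conj hg, dot_vec_conj hg hgn, dot_vec_conj hg hgn]
  have hform : ∀ x ∈ cylinder R, ∀ v w,
      kahlerForm h J (g * x) (g * v) (g * w) = kahlerForm h J x v w := by
    intro x hx v w
    have hρ := mem_cylinder_iff.1 hx
    obtain ⟨α, β, γ, κ, hv, hw, -⟩ :=
      exists_coeff_of_round (hE.oriented _ hρ) (hround _ hρ).1 (hround _ hρ).2
    rw [hconj x hx v, hconj x hx w, form_mul hE (hmem x hx), hgnorm]
    conv_rhs => rw [hback x hx v, hback x hx w, form_mul hE hx]
    rw [hv, hw, axis_const hK hE hround hρ hρ₀, ← hn, re_conj hg, re_conj hg]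
    simp only [smul_dotProduct, dot_vec_conj hg hgn, dot_cross_vec_conj hg hgn]
  refine fun x hx v w => ⟨hmet x hx v w, ?_⟩
  -- The metric is nondegenerate, so `J` is determined by `h` and `Ω`.
  have hgs : g * star g = 1 := by
    rw [Quaternion.self_mul_star, ← Quaternion.star_mul_self, hg]
  by_contra hne
  have hpos := hK.pos _ (hmem x hx) _ (sub_ne_zero.2 hne)
  have key : ∀ u, h (g * x) u (J (g * x) (g * v)) = h (g * x) u (g * J x v) := by
    intro u
    have hu : u = g * (star g * u) := by rw [← mul_assoc, hgs, one_mul]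
    have h1 := hform x hx (star g * u) v
    rw [← hu] at h1
    have h2 := hmet x hx (star g * u) (J x v)
    rw [← hu] at h2
    rw [h2]
    exact h1
  rw [map_sub, key, sub_self] at hpos
  exact lt_irrefl _ hpos

/-! ### Triangular coframes -/

/-- The third row of `M` shows that its axis is the third coordinate axis, so that `Mᵀ * M` is
diagonal with two equal entries. -/
lemma triangular_of_round {M : Matrix (Fin 3) (Fin 3) ℝ} (hM : 0 < M.det)
    (h1 : roundness M = 1) (h2 : tilt M = 0) {a b c b₁ c₁ c₂ : ℝ} (ha : 0 < a) (hb : 0 < b)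
    (hc : 0 < c) (hMe : M = !![a, b₁, c₁; 0, b, c₂; 0, 0, c]) :
    a = b ∧ b₁ = 0 ∧ c₁ = 0 ∧ c₂ = 0 := by
  obtain ⟨α, β, γ, κ, hv, -, hsum⟩ := exists_coeff_of_round hM h1 h2
  set n := axis M
  have r0 : M 0 = ![a, b₁, c₁] := by rw [hMe]; ext i; fin_cases i <;> rfl
  have r1 : M 1 = ![0, b, c₂] := by rw [hMe]; ext i; fin_cases i <;> rfl
  have r2 : M 2 = ![0, 0, c] := by rw [hMe]; ext i; fin_cases i <;> rfl
  have v0 := congrFun hv 0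
  have v1 := congrFun hv 1
  have v2 := congrFun hv 2
  rw [r2] at v0 v1 v2
  simp at v0 v1 v2
  have hγ : γ ≠ 0 := by rintro rfl; simp at v2; exact hc.ne' v2
  have n0 : n 0 = 0 := by tauto
  have n1 : n 1 = 0 := by tauto
  have s00 := hsum ![1, 0, 0] ![1, 0, 0]
  have s01 := hsum ![1, 0, 0] ![0, 1, 0]
  have s02 := hsum ![1, 0, 0] ![0, 0, 1]
  have s11 := hsum ![0, 1, 0] ![0, 1, 0]
  have s12 := hsum ![0, 1, 0] ![0, 0, 1]
  simp only [Fin.sum_univ_three, r0, r1, r2, dot3] at s00 s01 s02 s11 s12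
  simp [n0, n1] at s00 s01 s02 s11 s12
  have hb1 : b₁ = 0 := s01.resolve_left ha.ne'
  have hc1 : c₁ = 0 := s02.resolve_left ha.ne'
  subst hb1 hc1
  simp at s11 s12
  refine ⟨?_, rfl, rfl, ?_⟩
  · nlinarith
  · rcases s12 with h | h
    · exact absurd h hb.ne'
    · exact h

/-! ### Nuts -/

lemma eventually_radii_nhdsGT (hR : 0 < R) : ∀ᶠ ρ in 𝓝[>] (0 : ℝ), ρ ∈ radii R := by
  obtain ⟨r, h0, hlt⟩ := ENNReal.lt_iff_exists_nnreal_btwn.1 hR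
  have hr : (r : ℝ) ∈ radii R := ⟨by exact_mod_cast h0, by simpa using hlt⟩
  filter_upwards [Ioo_mem_nhdsGT hr.1] with ρ hρ using mem_radii_of_le hr hρ.1 hρ.2.le

lemma eventually_one_le_neg_log : ∀ᶠ ρ in 𝓝[>] (0 : ℝ), 1 ≤ -Real.log ρ :=
  (tendsto_neg_atBot_atTop.comp Real.tendsto_log_nhdsGT_zero).eventually_ge_atTop 1

lemma slowAtZero_of_isBigO
    (hv : ∀ k, (fun ρ => E ρ 2 k) =O[𝓝[>] 0] fun ρ => ρ * -Real.log ρ) : SlowAtZero E := by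
  have hsum : (fun ρ => Real.sqrt (E ρ 2 ⬝ᵥ E ρ 2)) =O[𝓝[>] 0] fun ρ => ρ * -Real.log ρ := by
    refine IsBigO.trans (g := fun ρ => ‖E ρ 2 0‖ + ‖E ρ 2 1‖ + ‖E ρ 2 2‖) ?_
      (((hv 0).norm_left.add (hv 1).norm_left).add (hv 2).norm_left)
    refine IsBigO.of_norm_le fun ρ => ?_
    rw [Real.norm_of_nonneg (Real.sqrt_nonneg _)]
    refine Real.sqrt_le_iff.2 ⟨by positivity, ?_⟩
    have e : ∀ x : ℝ, x * x = ‖x‖ * ‖x‖ := fun x => by simp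
    rw [dot3, e, e (E ρ 2 1), e (E ρ 2 2)]
    have := norm_nonneg (E ρ 2 0)
    have := norm_nonneg (E ρ 2 1)
    have := norm_nonneg (E ρ 2 2)
    nlinarith [mul_nonneg (norm_nonneg (E ρ 2 0)) (norm_nonneg (E ρ 2 1)),
      mul_nonneg (norm_nonneg (E ρ 2 0)) (norm_nonneg (E ρ 2 2)),
      mul_nonneg (norm_nonneg (E ρ 2 1)) (norm_nonneg (E ρ 2 2))]
  obtain ⟨C, hC⟩ := hsum.bound
  have hpos : ∀ᶠ ρ in 𝓝[>] (0 : ℝ), 0 < ρ := eventually_mem_nhdsWithin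
  obtain ⟨u, hu0, hu⟩ := mem_nhdsGT_iff_exists_Ioo_subset.1
    ((hC.and eventually_one_le_neg_log).and hpos)
  refine ⟨C, min u (1 / 2), lt_min hu0 (by norm_num), (min_le_right _ _).trans_lt (by norm_num),
    fun ρ hρ => ?_⟩
  obtain ⟨⟨h1, h2⟩, h3⟩ := hu ⟨hρ.1, hρ.2.trans_le (min_le_left _ _)⟩
  rw [Real.norm_of_nonneg (Real.sqrt_nonneg _), Real.norm_of_nonneg
    (mul_nonneg h3.le (by linarith))] at h1
  exact h1

lemma isBigO_id_mul_log :
    (fun ρ : ℝ => ρ) =O[𝓝[>] 0] fun ρ => ρ * -Real.log ρ := by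
  refine IsBigO.of_bound 1 ?_
  filter_upwards [eventually_one_le_neg_log] with ρ hρ
  rw [norm_mul, one_mul, Real.norm_of_nonneg (by linarith : 0 ≤ -Real.log ρ)]
  exact le_mul_of_one_le_right (norm_nonneg _) hρ

/-- The `k`-th imaginary unit at the point `ρ` has length at least `2 |E ρ 2 k| / ρ`, which is
bounded because the metric is continuous at the nut. -/
lemma slowAtZero_of_nut (hR : 0 < R) (hE : HasAdaptedCoframe R h J E) (hnut : SmoothAtNut R h) :
    SlowAtZero E := by
  obtain ⟨H, hH, -, hHh⟩ := hnut
  refine slowAtZero_of_isBigO fun k => IsBigO.trans ?_ isBigO_id_mul_log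
  set e : ℍ[ℝ] := imQ (Pi.single k 1) with he
  have hopen : IsOpen {x : ℍ[ℝ] | ‖x‖ₑ < R} := isOpen_lt continuous_enorm continuous_const
  have hcont : ContinuousAt H 0 :=
    (hH.contDiffAt (hopen.mem_nhds (by simpa using hR))).continuousAt
  have hcont2 : ContinuousAt (fun ρ : ℝ => H (ρ : ℍ[ℝ]) e e) 0 := by
    have h1 : ContinuousAt (fun ρ : ℝ => H (ρ : ℍ[ℝ])) 0 :=
      ContinuousAt.comp (g := H) (by simpa using hcont) Quaternion.continuous_coe.continuousAt
    exact (h1.clm_apply continuousAt_const).clm_apply continuousAt_const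
  have hle : ∀ᶠ ρ : ℝ in 𝓝[>] 0, H (ρ : ℍ[ℝ]) e e < H 0 e e + 1 := by
    have := hcont2.eventually_lt_const (u := H 0 e e + 1) (by simp)
    exact nhdsWithin_le_nhds this
  refine IsBigO.of_bound (Real.sqrt (|H 0 e e + 1| / 4)) ?_
  filter_upwards [hle, eventually_radii_nhdsGT hR] with ρ hρ hmem
  rw [hHh _ (coe_mem_cylinder hmem), metric_real hE hmem] at hρ
  have h0 : 0 < ρ := hmem.1
  simp only [he, vec_imQ, re_imQ, mul_zero, zero_add, dotProduct_single, mul_one,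
    Fin.sum_univ_three] at hρ
  rw [← he] at hρ
  rw [Real.norm_eq_abs, Real.norm_of_nonneg h0.le]
  refine abs_le_of_sq_le_sq ?_ (by positivity)
  rw [mul_pow, Real.sq_sqrt (by positivity)]
  have h1 : 4 / ρ ^ 2 * (E ρ 2 k) ^ 2 ≤ |H 0 e e + 1| := by
    refine le_trans ?_ (hρ.le.trans (le_abs_self _))
    refine mul_le_mul_of_nonneg_left ?_ (by positivity)
    nlinarith [sq_nonneg (E ρ 0 k), sq_nonneg (E ρ 1 k)]
  rw [div_mul_eq_mul_div, div_le_iff₀ (by positivity)] at h1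
  linarith

/-! ### A singular scalar equation -/

/-- Solutions of `y' = (l / ρ) y + O(ρ)` that are `o(ρ)` at `0`, for `l ≤ 1`: the homogeneous
solution `ρ ^ l` is not `o(ρ)`, so it does not contribute. -/
lemma deriv_isBigO_of_le_one {y y' : ℝ → ℝ} {l : ℝ} (hl : l ≤ 1)
    (hy : ∀ᶠ ρ in 𝓝[>] 0, HasDerivAt y (y' ρ) ρ)
    (hode : (fun ρ => y' ρ - l / ρ * y ρ) =O[𝓝[>] 0] fun ρ => ρ)
    (hsmall : y =o[𝓝[>] 0] fun ρ => ρ) : y' =O[𝓝[>] 0] fun ρ => ρ := by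
  obtain ⟨C, hC0, hC⟩ := hode.exists_nonneg
  have hC := hC.bound
  obtain ⟨u, hu0, hu⟩ := mem_nhdsGT_iff_exists_Ioo_subset.1 (hy.and hC)
  have hu0 : (0 : ℝ) < u := hu0
  set z : ℝ → ℝ := fun ρ => ρ ^ (-l) * y ρ with hz
  have hzd : ∀ ρ ∈ Set.Ioo 0 u, HasDerivAt z (ρ ^ (-l) * (y' ρ - l / ρ * y ρ)) ρ := by
    intro ρ hρ
    refine ((Real.hasDerivAt_rpow_const (p := -l) (Or.inl hρ.1.ne')).mul (hu hρ).1).congr_deriv ?_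
    rw [Real.rpow_sub_one hρ.1.ne']
    have := hρ.1.ne'
    field_simp
    ring
  have hzbound : ∀ ρ ∈ Set.Ioo 0 u, ∀ s ∈ Set.Ioc 0 ρ,
      ‖s ^ (-l) * (y' s - l / s * y s)‖ ≤ C * ρ ^ (1 - l) := by
    intro ρ hρ s hs
    have hs' : s ∈ Set.Ioo 0 u := ⟨hs.1, hs.2.trans_lt hρ.2⟩
    have h1 := (hu hs').2
    rw [Real.norm_of_nonneg hs.1.le] at h1
    rw [norm_mul, Real.norm_of_nonneg (Real.rpow_nonneg hs.1.le _)]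
    calc s ^ (-l) * ‖y' s - l / s * y s‖ ≤ s ^ (-l) * (C * s) :=
          mul_le_mul_of_nonneg_left h1 (Real.rpow_nonneg hs.1.le _)
      _ = C * s ^ (1 - l) := by
          rw [sub_eq_neg_add, Real.rpow_add hs.1, Real.rpow_one]; ring
      _ ≤ C * ρ ^ (1 - l) := mul_le_mul_of_nonneg_left
          (Real.rpow_le_rpow hs.1.le hs.2 (by linarith)) hC0
  have hz0 : Tendsto z (𝓝[>] 0) (𝓝 0) := by
    have h1 : z =O[𝓝[>] 0] fun ρ => y ρ / ρ := by
      refine IsBigO.of_bound 1 ?_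
      filter_upwards [Ioo_mem_nhdsGT (one_pos : (0 : ℝ) < 1)] with ρ hρ
      have h2 : z ρ = ρ ^ (1 - l) * (y ρ / ρ) := by
        rw [hz, sub_eq_neg_add, Real.rpow_add hρ.1, Real.rpow_one]
        have := hρ.1.ne'
        field_simp
      rw [h2, norm_mul, Real.norm_of_nonneg (Real.rpow_nonneg hρ.1.le _)]
      exact mul_le_mul_of_nonneg_right (Real.rpow_le_one hρ.1.le hρ.2.le (by linarith))
        (norm_nonneg _)
    exact h1.trans_tendsto hsmall.tendsto_div_nhds_zero
  have hyb : ∀ ρ ∈ Set.Ioo 0 u, |y ρ| ≤ C * ρ ^ 2 := by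
    intro ρ hρ
    have h1 : ∀ᶠ s in 𝓝[>] 0, ‖z ρ - z s‖ ≤ C * ρ ^ (1 - l) * ρ := by
      filter_upwards [Ioo_mem_nhdsGT hρ.1] with s hs
      have h2 := (convex_Icc s ρ).norm_image_sub_le_of_norm_hasDerivWithin_le
        (fun t ht => (hzd t ⟨hs.1.trans_le ht.1, ht.2.trans_lt hρ.2⟩).hasDerivWithinAt)
        (fun t ht => hzbound ρ hρ t ⟨hs.1.trans_le ht.1, ht.2⟩)
        (Set.left_mem_Icc.2 hs.2.le) (Set.right_mem_Icc.2 hs.2.le)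
      refine h2.trans (mul_le_mul_of_nonneg_left ?_
        (mul_nonneg hC0 (Real.rpow_nonneg hρ.1.le _)))
      rw [Real.norm_of_nonneg (by linarith [hs.2])]
      linarith [hs.1]
    have h2 := le_of_tendsto (((tendsto_const_nhds (x := z ρ)).sub hz0).norm) h1
    rw [sub_zero, hz, norm_mul, Real.norm_of_nonneg (Real.rpow_nonneg hρ.1.le _),
      sub_eq_neg_add, Real.rpow_add hρ.1, Real.rpow_one] at h2
    have h3 : 0 < ρ ^ (-l) := Real.rpow_pos_of_pos hρ.1 _
    rw [← Real.norm_eq_abs]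
    refine le_of_mul_le_mul_left (h2.trans_eq ?_) h3
    ring
  refine IsBigO.of_bound (C + |l| * C) ?_
  filter_upwards [Ioo_mem_nhdsGT hu0] with ρ hρ
  have h1 := (hu hρ).2
  have h2 := hyb ρ hρ
  rw [Real.norm_of_nonneg hρ.1.le] at h1 ⊢
  have h3 : ‖l / ρ * y ρ‖ ≤ |l| * C * ρ := by
    rw [norm_mul, norm_div, Real.norm_eq_abs, Real.norm_eq_abs, Real.norm_eq_abs,
      abs_of_pos hρ.1]
    calc |l| / ρ * |y ρ| ≤ |l| / ρ * (C * ρ ^ 2) :=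
          mul_le_mul_of_nonneg_left h2 (div_nonneg (abs_nonneg _) hρ.1.le)
      _ = |l| * C * ρ := by have := hρ.1.ne'; field_simp
  calc ‖y' ρ‖ = ‖(y' ρ - l / ρ * y ρ) + l / ρ * y ρ‖ := by ring_nf
    _ ≤ C * ρ + |l| * C * ρ := (norm_add_le _ _).trans (add_le_add h1 h3)
    _ = _ := by ring

/-- Solutions of `y' = (2 / ρ) y + O(ρ)` at `0`: the homogeneous solution `ρ ^ 2` is in resonance
with the error term, which causes a logarithm. -/
lemma deriv_isBigO_of_eq_two {y y' : ℝ → ℝ}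
    (hy : ∀ᶠ ρ in 𝓝[>] 0, HasDerivAt y (y' ρ) ρ)
    (hode : (fun ρ => y' ρ - 2 / ρ * y ρ) =O[𝓝[>] 0] fun ρ => ρ) :
    y' =O[𝓝[>] 0] fun ρ => ρ * -Real.log ρ := by
  obtain ⟨C, hC0, hC⟩ := hode.exists_nonneg
  have hC := hC.bound
  obtain ⟨u, hu0, hu⟩ := mem_nhdsGT_iff_exists_Ioo_subset.1 (hy.and hC)
  have hu0 : (0 : ℝ) < u := hu0
  set z : ℝ → ℝ := fun ρ => (ρ ^ 2)⁻¹ * y ρ with hz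
  have hzd : ∀ ρ ∈ Set.Ioo 0 u, HasDerivAt z ((ρ ^ 2)⁻¹ * (y' ρ - 2 / ρ * y ρ)) ρ := by
    intro ρ hρ
    have h0 := hρ.1.ne'
    refine ((((hasDerivAt_id ρ).pow 2).inv (by simpa using h0)).mul (hu hρ).1).congr_deriv ?_
    simp
    field_simp
    ring
  have hzb : ∀ ρ ∈ Set.Ioo 0 u, |(ρ ^ 2)⁻¹ * (y' ρ - 2 / ρ * y ρ)| ≤ C * ρ⁻¹ := by
    intro ρ hρ
    have h0 := hρ.1
    have h1 := (hu hρ).2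
    rw [Real.norm_of_nonneg h0.le, Real.norm_eq_abs] at h1
    rw [abs_mul, abs_of_pos (by positivity)]
    calc (ρ ^ 2)⁻¹ * |y' ρ - 2 / ρ * y ρ| ≤ (ρ ^ 2)⁻¹ * (C * ρ) :=
          mul_le_mul_of_nonneg_left h1 (by positivity)
      _ = C * ρ⁻¹ := by field_simp
  have hm1 : MonotoneOn (fun ρ => C * Real.log ρ - z ρ) (Set.Ioo 0 u) :=
    monotoneOn_of_hasDerivAt_nonneg (convex_Ioo 0 u)
      (fun ρ hρ => ((Real.hasDerivAt_log hρ.1.ne').const_mul C).sub (hzd ρ hρ))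
      fun ρ hρ => by linarith [(abs_le.1 (hzb ρ hρ)).2]
  have hm2 : MonotoneOn (fun ρ => C * Real.log ρ + z ρ) (Set.Ioo 0 u) :=
    monotoneOn_of_hasDerivAt_nonneg (convex_Ioo 0 u)
      (fun ρ hρ => ((Real.hasDerivAt_log hρ.1.ne').const_mul C).add (hzd ρ hρ))
      fun ρ hρ => by linarith [(abs_le.1 (hzb ρ hρ)).1]
  set D := |C * Real.log (u / 2)| + |z (u / 2)| with hD
  have hmid : u / 2 ∈ Set.Ioo 0 u := ⟨by linarith, by linarith⟩
  refine IsBigO.of_bound (C + 2 * (C + D)) ?_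
  filter_upwards [Ioo_mem_nhdsGT (half_pos hu0), eventually_one_le_neg_log] with ρ hρ hlog
  have hρ' : ρ ∈ Set.Ioo 0 u := ⟨hρ.1, by linarith [hρ.2]⟩
  have h0 := hρ.1
  have k1 := hm1 hρ' hmid hρ.2.le
  have k2 := hm2 hρ' hmid hρ.2.le
  simp only at k1 k2
  have hD0 : 0 ≤ D := by positivity
  have k3 : |z ρ| ≤ C * -Real.log ρ + D := by
    rw [abs_le]
    have a1 := neg_abs_le (C * Real.log (u / 2))
    have a2 := le_abs_self (C * Real.log (u / 2))
    have a3 := neg_abs_le (z (u / 2))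
    have a4 := le_abs_self (z (u / 2))
    constructor <;> linarith
  have k4 : |z ρ| ≤ (C + D) * -Real.log ρ := by nlinarith
  have k5 := (hu hρ').2
  rw [Real.norm_of_nonneg h0.le] at k5
  rw [Real.norm_of_nonneg (mul_nonneg h0.le (by linarith))]
  have k6 : 2 / ρ * y ρ = 2 * ρ * z ρ := by rw [hz]; field_simp
  rw [k6] at k5
  calc ‖y' ρ‖ = ‖(y' ρ - 2 * ρ * z ρ) + 2 * ρ * z ρ‖ := by ring_nf
    _ ≤ C * ρ + 2 * ρ * |z ρ| := by
        refine (norm_add_le _ _).trans (add_le_add k5 ?_)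
        rw [norm_mul, Real.norm_of_nonneg (by positivity), Real.norm_eq_abs]
    _ ≤ C * ρ * -Real.log ρ + 2 * ρ * ((C + D) * -Real.log ρ) :=
        add_le_add (le_mul_of_one_le_right (by positivity) hlog)
          (mul_le_mul_of_nonneg_left k4 (by positivity))
    _ = _ := by ring

/-! ### Asymptotics at a complex bolt -/

lemma gram_mulVec_cof (M : Matrix (Fin 3) (Fin 3) ℝ) (i : Fin 3) :
    ((Mᵀ * M) *ᵥ cof M 2) i = M.det * M 2 i := by
  have h1 : M *ᵥ cof M 2 = ![0, 0, M.det] := by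
    apply vec3_ext
    · exact row_dot_cof M 0 2
    · exact row_dot_cof M 1 2
    · exact row_dot_cof M 2 2
  rw [← Matrix.mulVec_mulVec, h1]
  simp [Matrix.mulVec, dotProduct, Fin.sum_univ_three, mul_comm]

lemma gram_symm (M : Matrix (Fin 3) (Fin 3) ℝ) (i j : Fin 3) : (Mᵀ * M) i j = (Mᵀ * M) j i := by
  rw [← Matrix.transpose_apply (Mᵀ * M), Matrix.transpose_mul, Matrix.transpose_transpose]

lemma sq_det_eq_gram (M : Matrix (Fin 3) (Fin 3) ℝ) {G : Matrix (Fin 3) (Fin 3) ℝ}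
    (hG : G = Mᵀ * M) : M.det ^ 2 = G 0 0 * G 1 1 * G 2 2 + 2 * (G 0 1 * G 0 2 * G 1 2)
      - G 0 0 * G 1 2 ^ 2 - G 1 1 * G 0 2 ^ 2 - G 2 2 * G 0 1 ^ 2 := by
  have hs : ∀ i j, G i j = G j i := fun i j => hG ▸ gram_symm M i j
  have : M.det ^ 2 = G.det := by rw [hG, Matrix.det_mul, Matrix.det_transpose, pow_two]
  rw [this, Matrix.det_fin_three, hs 1 0, hs 2 0, hs 2 1]
  ring

lemma cof_two_isBigO_one (hR : 0 < R) (hK : IsKahlerOn (cylinder R) h J)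
    (hE : HasAdaptedCoframe R h J E) (i : Fin 3) :
    (fun ρ => cof (E ρ) 2 i) =O[𝓝[>] 0] fun _ => (1 : ℝ) := by
  obtain ⟨ρ₁, hρ₁⟩ := (eventually_radii_nhdsGT hR).exists
  refine IsBigO.of_bound (Real.sqrt (cof (E ρ₁) 2 ⬝ᵥ cof (E ρ₁) 2)) ?_
  filter_upwards [Ioo_mem_nhdsGT hρ₁.1] with ρ hρ
  have hmono := monotoneOn_sq_cof hK hE (mem_radii_of_le hρ₁ hρ.1 hρ.2.le) hρ₁ hρ.2.le
  rw [norm_one, mul_one, Real.norm_eq_abs]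
  refine Real.abs_le_sqrt (le_trans ?_ hmono)
  simp only [dot3]
  fin_cases i <;> simp <;> nlinarith [sq_nonneg (cof (E ρ) 2 0), sq_nonneg (cof (E ρ) 2 1),
    sq_nonneg (cof (E ρ) 2 2)]

/-- The asymptotic form of the coefficients `Eᵀ E` of the metric in the basis `σᵢ` at a bolt: to
leading order the metric is `dρ² + q (σ₁² + σ₂²) + P² ρ² σ₃²`. -/
structure BoltAsymptotics (E : ℝ → Matrix (Fin 3) (Fin 3) ℝ) (q P : ℝ) : Prop where
  zero_zero : (fun ρ => ((E ρ)ᵀ * E ρ) 0 0 - q) =O[𝓝[>] 0] fun ρ => ρ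
  one_one : (fun ρ => ((E ρ)ᵀ * E ρ) 1 1 - q) =O[𝓝[>] 0] fun ρ => ρ
  zero_one : (fun ρ => ((E ρ)ᵀ * E ρ) 0 1) =O[𝓝[>] 0] fun ρ => ρ
  zero_two : (fun ρ => ((E ρ)ᵀ * E ρ) 0 2) =O[𝓝[>] 0] fun ρ => ρ ^ 2
  one_two : (fun ρ => ((E ρ)ᵀ * E ρ) 1 2) =O[𝓝[>] 0] fun ρ => ρ ^ 2
  two_two : (fun ρ => ((E ρ)ᵀ * E ρ) 2 2 - P ^ 2 * ρ ^ 2) =O[𝓝[>] 0] fun ρ => ρ ^ 3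

lemma isBigO_pow_of_le {m n : ℕ} (hmn : m ≤ n) :
    (fun ρ : ℝ => ρ ^ n) =O[𝓝[>] 0] fun ρ => ρ ^ m := by
  refine IsBigO.of_bound 1 ?_
  filter_upwards [Ioo_mem_nhdsGT (one_pos : (0 : ℝ) < 1)] with ρ hρ
  rw [norm_pow, norm_pow, one_mul, Real.norm_of_nonneg hρ.1.le]
  exact pow_le_pow_of_le_one hρ.1.le hρ.2.le hmn

/-- Products of functions with `O(ρ^m)` bounds. -/
lemma isBigO_mul_pow {f g : ℝ → ℝ} {m n k : ℕ} (hf : f =O[𝓝[>] 0] fun ρ => ρ ^ m)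
    (hg : g =O[𝓝[>] 0] fun ρ => ρ ^ n) (hk : k ≤ m + n) :
    (fun ρ => f ρ * g ρ) =O[𝓝[>] 0] fun ρ => ρ ^ k := by
  refine (hf.mul hg).trans ?_
  simp only [← pow_add]
  exact isBigO_pow_of_le hk

/-- The determinant is the positive square root of `det (Eᵀ E) = (q P ρ)² + O(ρ³)`. -/
lemma det_asymptotics (hR : 0 < R) (hE : HasAdaptedCoframe R h J E) {q P : ℝ} (hq : 0 < q)
    (hP : 0 < P) (hB : BoltAsymptotics E q P) :
    (fun ρ => (E ρ).det - q * P * ρ) =O[𝓝[>] 0] fun ρ => ρ ^ 2 := by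
  set G : ℝ → Matrix (Fin 3) (Fin 3) ℝ := fun ρ => (E ρ)ᵀ * E ρ with hG
  have c0 : ∀ c : ℝ, (fun _ : ℝ => c) =O[𝓝[>] (0 : ℝ)] fun ρ => ρ ^ 0 := fun c => by
    simpa using isBigO_const_one ℝ c _
  have a00 : (fun ρ => G ρ 0 0 - q) =O[𝓝[>] 0] fun ρ => ρ ^ 1 := by simpa using hB.zero_zero
  have a11 : (fun ρ => G ρ 1 1 - q) =O[𝓝[>] 0] fun ρ => ρ ^ 1 := by simpa using hB.one_one
  have a01 : (fun ρ => G ρ 0 1) =O[𝓝[>] 0] fun ρ => ρ ^ 1 := by simpa using hB.zero_one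
  have a02 : (fun ρ => G ρ 0 2) =O[𝓝[>] 0] fun ρ => ρ ^ 2 := hB.zero_two
  have a12 : (fun ρ => G ρ 1 2) =O[𝓝[>] 0] fun ρ => ρ ^ 2 := hB.one_two
  have a22 : (fun ρ => G ρ 2 2 - P ^ 2 * ρ ^ 2) =O[𝓝[>] 0] fun ρ => ρ ^ 3 := hB.two_two
  have b00 : (fun ρ => G ρ 0 0) =O[𝓝[>] 0] fun ρ => ρ ^ 0 := by
    simpa using (a00.trans (isBigO_pow_of_le (Nat.zero_le 1))).add (c0 q)
  have b11 : (fun ρ => G ρ 1 1) =O[𝓝[>] 0] fun ρ => ρ ^ 0 := by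
    simpa using (a11.trans (isBigO_pow_of_le (Nat.zero_le 1))).add (c0 q)
  have bP : (fun ρ => P ^ 2 * ρ ^ 2) =O[𝓝[>] 0] fun ρ : ℝ => ρ ^ 2 :=
    (isBigO_refl _ _).const_mul_left _
  have b22 : (fun ρ => G ρ 2 2) =O[𝓝[>] 0] fun ρ => ρ ^ 2 := by
    simpa using (a22.trans (isBigO_pow_of_le (by norm_num : 2 ≤ 3))).add bP
  have hdiff : (fun ρ => (E ρ).det ^ 2 - (q * P * ρ) ^ 2) =O[𝓝[>] 0] fun ρ => ρ ^ 3 := by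
    have t1 := isBigO_mul_pow (k := 3) a22 (isBigO_mul_pow (k := 0) b00 b11 le_rfl) (by norm_num)
    have t2 := isBigO_mul_pow (k := 3) bP (isBigO_mul_pow (k := 1) a00 b11 le_rfl) (by norm_num)
    have t3 := isBigO_mul_pow (k := 3) bP (isBigO_mul_pow (k := 1) (c0 q) a11 le_rfl)
      (by norm_num)
    have t4 := isBigO_mul_pow (k := 3) a01 (isBigO_mul_pow (k := 4) a02 a12 le_rfl) (by norm_num)
    have t5 := isBigO_mul_pow (k := 3) b00 (isBigO_mul_pow (k := 4) a12 a12 le_rfl) (by norm_num)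
    have t6 := isBigO_mul_pow (k := 3) b11 (isBigO_mul_pow (k := 4) a02 a02 le_rfl) (by norm_num)
    have t7 := isBigO_mul_pow (k := 3) b22 (isBigO_mul_pow (k := 2) a01 a01 le_rfl) (by norm_num)
    refine ((((((t1.add t2).add t3).add (t4.const_mul_left 2)).sub t5).sub t6).sub t7).congr_left
      fun ρ => ?_
    rw [sq_det_eq_gram (E ρ) (G := G ρ) rfl]
    ring
  obtain ⟨C, hC⟩ := hdiff.bound
  refine IsBigO.of_bound (C / (q * P)) ?_
  filter_upwards [hC, eventually_radii_nhdsGT hR] with ρ h1 hρ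
  have hd := hE.oriented ρ hρ
  have h0 := hρ.1
  have hpos : 0 < q * P * ρ := by positivity
  have h2 : ‖(E ρ).det - q * P * ρ‖ * (q * P * ρ) ≤ C * ρ ^ 3 := by
    rw [Real.norm_of_nonneg (by positivity : 0 ≤ ρ ^ 3)] at h1
    refine le_trans ?_ h1
    rw [show (E ρ).det ^ 2 - (q * P * ρ) ^ 2
      = ((E ρ).det - q * P * ρ) * ((E ρ).det + q * P * ρ) by ring, norm_mul]
    refine mul_le_mul_of_nonneg_left ?_ (norm_nonneg _)
    rw [Real.norm_of_nonneg (by positivity)]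
    linarith
  rw [Real.norm_of_nonneg (by positivity : 0 ≤ ρ ^ 2), div_mul_eq_mul_div,
    le_div_iff₀ (by positivity)]
  refine le_of_mul_le_mul_right ?_ h0
  linarith

/-- The components along the bolt of `w = E₀ × E₁` satisfy a singular equation, since `w' = E₂` and
`det(E) E₂ = Eᵀ E w`. Here `v`, `d`, `G₀`, `G₁` stand for the derivative of `w`, for `det E`, and
for the coefficients of the metric along the bolt; `w₁` is the other component, and `r` is the
contribution of the third one. -/
lemma bolt_ode {w w₁ v : ℝ → ℝ} {G₀ G₁ d r : ℝ → ℝ} {q P : ℝ} (hq : 0 < q) (hP : 0 < P)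
    (hd : (fun ρ => d ρ - q * P * ρ) =O[𝓝[>] 0] fun ρ => ρ ^ 2)
    (hG₀ : (fun ρ => G₀ ρ - q) =O[𝓝[>] 0] fun ρ => ρ ^ 1)
    (hG₁ : G₁ =O[𝓝[>] 0] fun ρ => ρ ^ 1) (hr : r =O[𝓝[>] 0] fun ρ => ρ ^ 2)
    (hw : w =O[𝓝[>] 0] fun ρ => ρ ^ 1) (hw₁ : w₁ =O[𝓝[>] 0] fun ρ => ρ ^ 1)
    (hv : Tendsto v (𝓝[>] 0) (𝓝 0))
    (heq : ∀ᶠ ρ in 𝓝[>] 0, d ρ * v ρ = G₀ ρ * w ρ + G₁ ρ * w₁ ρ + r ρ) :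
    w =o[𝓝[>] 0] (fun ρ => ρ) ∧
      (fun ρ => v ρ - P⁻¹ / ρ * w ρ) =O[𝓝[>] 0] fun ρ => ρ := by
  have hv1 : v =O[𝓝[>] 0] fun ρ => ρ ^ 0 := by simpa using hv.isBigO_one ℝ
  have herr : (fun ρ => q * P * ρ * v ρ - q * w ρ) =O[𝓝[>] 0] fun ρ => ρ ^ 2 := by
    have t1 := isBigO_mul_pow (k := 2) hG₀ hw le_rfl
    have t2 := isBigO_mul_pow (k := 2) hG₁ hw₁ le_rfl
    have t3 := isBigO_mul_pow (k := 2) hd hv1 le_rfl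
    refine (((t1.add t2).add hr).sub t3).congr' ?_ EventuallyEq.rfl
    filter_upwards [heq] with ρ hρ
    linear_combination -hρ
  have hpos : ∀ᶠ ρ in 𝓝[>] (0 : ℝ), 0 < ρ := eventually_mem_nhdsWithin
  constructor
  · have s1 : (fun ρ : ℝ => q * P * ρ * v ρ) =o[𝓝[>] 0] fun ρ => ρ := by
      have := ((isBigO_refl (fun ρ : ℝ => ρ) (𝓝[>] 0)).const_mul_left (q * P)).mul_isLittleO
        ((isLittleO_one_iff ℝ).2 hv)
      simpa using this
    have s2 : (fun ρ : ℝ => ρ ^ 2) =o[𝓝[>] 0] fun ρ => ρ := by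
      have : (fun ρ : ℝ => ρ ^ 2) =o[𝓝 0] fun ρ => ρ ^ 1 := isLittleO_pow_pow (by norm_num)
      simpa using this.mono nhdsWithin_le_nhds
    refine ((s1.sub (herr.trans_isLittleO s2)).const_mul_left q⁻¹).congr_left fun ρ => ?_
    field_simp
    ring
  · have s1 := (isBigO_refl (fun ρ : ℝ => (q * P * ρ)⁻¹) (𝓝[>] 0)).mul herr
    refine (s1.congr' ?_ EventuallyEq.rfl).trans ?_
    · filter_upwards [hpos] with ρ h0
      field_simp
    · refine IsBigO.of_bound (q * P)⁻¹ ?_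
      filter_upwards [hpos] with ρ h0
      rw [Real.norm_of_nonneg (by positivity), Real.norm_of_nonneg h0.le]
      apply le_of_eq
      field_simp

/-- The condition on `P` holds for `P = p / 2` with an integer `p ≥ 1`. -/
lemma slowAtZero_of_boltAsymptotics (hR : 0 < R) (hK : IsKahlerOn (cylinder R) h J)
    (hE : HasAdaptedCoframe R h J E) {q P : ℝ} (hq : 0 < q) (hP : 0 < P)
    (hP' : P⁻¹ ≤ 1 ∨ P⁻¹ = 2) (hB : BoltAsymptotics E q P)
    (h0 : Tendsto (fun ρ => E ρ 2 0) (𝓝[>] 0) (𝓝 0))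
    (h1 : Tendsto (fun ρ => E ρ 2 1) (𝓝[>] 0) (𝓝 0)) : SlowAtZero E := by
  set G : ℝ → Matrix (Fin 3) (Fin 3) ℝ := fun ρ => (E ρ)ᵀ * E ρ with hG
  have hs : ∀ ρ i j, G ρ i j = G ρ j i := fun ρ => gram_symm (E ρ)
  have a00 : (fun ρ => G ρ 0 0 - q) =O[𝓝[>] 0] fun ρ => ρ ^ 1 := by simpa using hB.zero_zero
  have a11 : (fun ρ => G ρ 1 1 - q) =O[𝓝[>] 0] fun ρ => ρ ^ 1 := by simpa using hB.one_one
  have a01 : (fun ρ => G ρ 0 1) =O[𝓝[>] 0] fun ρ => ρ ^ 1 := by simpa using hB.zero_one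
  have a10 : (fun ρ => G ρ 1 0) =O[𝓝[>] 0] fun ρ => ρ ^ 1 := by simpa only [hs _ 1 0] using a01
  have hd := det_asymptotics hR hE hq hP hB
  have hd1 : (fun ρ => (E ρ).det) =O[𝓝[>] 0] fun ρ => ρ ^ 1 := by
    have : (fun ρ : ℝ => q * P * ρ) =O[𝓝[>] 0] fun ρ => ρ ^ 1 := by
      simpa using (isBigO_refl (fun ρ : ℝ => ρ) (𝓝[>] 0)).const_mul_left (q * P)
    simpa using (hd.trans (isBigO_pow_of_le (by norm_num : 1 ≤ 2))).add this
  have hw : ∀ i, (fun ρ => cof (E ρ) 2 i) =O[𝓝[>] 0] fun ρ => ρ ^ 0 := fun i => by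
    simpa using cof_two_isBigO_one hR hK hE i
  have hv : ∀ {i}, Tendsto (fun ρ => E ρ 2 i) (𝓝[>] 0) (𝓝 0) →
      (fun ρ => E ρ 2 i) =O[𝓝[>] 0] fun ρ => ρ ^ 0 := fun hi => by simpa using hi.isBigO_one ℝ
  have e0 : ∀ ρ, (E ρ).det * E ρ 2 0 = G ρ 0 0 * cof (E ρ) 2 0 + G ρ 0 1 * cof (E ρ) 2 1
      + G ρ 0 2 * cof (E ρ) 2 2 := fun ρ => by
    rw [← gram_mulVec_cof]; simp [hG, Matrix.mulVec, dot3]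
  have e1 : ∀ ρ, (E ρ).det * E ρ 2 1 = G ρ 1 1 * cof (E ρ) 2 1 + G ρ 1 0 * cof (E ρ) 2 0
      + G ρ 1 2 * cof (E ρ) 2 2 := fun ρ => by
    rw [← gram_mulVec_cof]; simp [hG, Matrix.mulVec, dot3]; ring
  have r0 := isBigO_mul_pow (k := 2) hB.zero_two (hw 2) le_rfl
  have r1 := isBigO_mul_pow (k := 2) hB.one_two (hw 2) le_rfl
  -- The components of `w` along the bolt are first seen to be `O(ρ)`.
  have w0 : (fun ρ => cof (E ρ) 2 0) =O[𝓝[>] 0] fun ρ => ρ ^ 1 := by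
    have t1 := isBigO_mul_pow (k := 1) hd1 (hv h0) le_rfl
    have t2 := isBigO_mul_pow (k := 1) a00 (hw 0) le_rfl
    have t3 := isBigO_mul_pow (k := 1) a01 (hw 1) le_rfl
    have t4 := r0.trans (isBigO_pow_of_le (by norm_num : 1 ≤ 2))
    refine ((((t1.sub t2).sub t3).sub t4).const_mul_left q⁻¹).congr_left fun ρ => ?_
    rw [e0]
    field_simp
    ring
  have w1 : (fun ρ => cof (E ρ) 2 1) =O[𝓝[>] 0] fun ρ => ρ ^ 1 := by
    have t1 := isBigO_mul_pow (k := 1) hd1 (hv h1) le_rfl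
    have t2 := isBigO_mul_pow (k := 1) a11 (hw 1) le_rfl
    have t3 := isBigO_mul_pow (k := 1) a10 (hw 0) le_rfl
    have t4 := r1.trans (isBigO_pow_of_le (by norm_num : 1 ≤ 2))
    refine ((((t1.sub t2).sub t3).sub t4).const_mul_left q⁻¹).congr_left fun ρ => ?_
    rw [e1]
    field_simp
    ring
  have o0 := bolt_ode hq hP hd a00 a01 r0 w0 w1 h0 (Eventually.of_forall e0)
  have o1 := bolt_ode hq hP hd a11 a10 r1 w1 w0 h1 (Eventually.of_forall e1)
  have hder : ∀ i, ∀ᶠ ρ in 𝓝[>] (0 : ℝ), HasDerivAt (fun s => cof (E s) 2 i) (E ρ 2 i) ρ :=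
    fun i => by
      filter_upwards [eventually_radii_nhdsGT hR] with ρ hρ
      exact (hasDerivAt_pi.1 (hasDerivAt_cof_two hK hE hρ)) i
  have concl : ∀ i, (fun ρ => cof (E ρ) 2 i) =o[𝓝[>] 0] (fun ρ => ρ) →
      ((fun ρ => E ρ 2 i - P⁻¹ / ρ * cof (E ρ) 2 i) =O[𝓝[>] 0] fun ρ => ρ) →
      (fun ρ => E ρ 2 i) =O[𝓝[>] 0] fun ρ => ρ * -Real.log ρ := by
    intro i k1 k2
    rcases hP' with hP' | hP'
    · exact (deriv_isBigO_of_le_one hP' (hder i) k2 k1).trans isBigO_id_mul_log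
    · rw [hP'] at k2
      exact deriv_isBigO_of_eq_two (hder i) k2
  refine slowAtZero_of_isBigO fun k => ?_
  fin_cases k
  · exact concl 0 o0.1 o0.2
  · exact concl 1 o1.1 o1.2
  · refine IsBigO.trans ?_ isBigO_id_mul_log
    have b22 : (fun ρ => G ρ 2 2) =O[𝓝[>] 0] fun ρ => ρ ^ 2 := by
      have bP : (fun ρ => P ^ 2 * ρ ^ 2) =O[𝓝[>] 0] fun ρ : ℝ => ρ ^ 2 :=
        (isBigO_refl _ _).const_mul_left _
      simpa [hG] using (hB.two_two.trans (isBigO_pow_of_le (by norm_num : 2 ≤ 3))).add bP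
    refine IsBigO.of_pow (n := 2) two_ne_zero (IsBigO.trans ?_ b22)
    refine IsBigO.of_norm_le fun ρ => ?_
    rw [Pi.pow_apply, Real.norm_of_nonneg (sq_nonneg _)]
    simp only [hG, Matrix.mul_apply, Matrix.transpose_apply, Fin.sum_univ_three]
    change E ρ 2 2 ^ 2 ≤ _
    nlinarith [sq_nonneg (E ρ 0 2), sq_nonneg (E ρ 1 2)]

/-! ### The metric near a bolt -/

@[simp] lemma re_ofC (t : ℂ) : (ofC t).re = t.re := rfl
@[simp] lemma imI_ofC (t : ℂ) : (ofC t).imI = 0 := rfl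
@[simp] lemma imJ_ofC (t : ℂ) : (ofC t).imJ = 0 := rfl
@[simp] lemma imK_ofC (t : ℂ) : (ofC t).imK = t.im := rfl

/-- The inclusion `ofC` as a continuous linear map. -/
def ofCL : ℂ →L[ℝ] ℍ[ℝ] :=
  LinearMap.toContinuousLinearMap
    { toFun := ofC
      map_add' := fun a b => by ext <;> simp
      map_smul' := fun r a => by ext <;> simp }

@[simp] lemma ofCL_apply (t : ℂ) : ofCL t = ofC t := rfl

lemma norm_ofC (t : ℂ) : ‖ofC t‖ = ‖t‖ := by
  have h1 : ‖ofC t‖ * ‖ofC t‖ = ‖t‖ * ‖t‖ := by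
    rw [← Quaternion.normSq_eq_norm_mul_self, Quaternion.normSq_def',
      Complex.norm_mul_self_eq_normSq, Complex.normSq_apply]
    simp; ring
  exact (mul_self_inj (norm_nonneg _) (norm_nonneg _)).1 h1

lemma hopfChart_zero (t : ℂ) : hopfChart (t, 0) = ofC t := by
  have : ofC 0 = 0 := ofCL.map_zero
  simp [hopfChart, this]

lemma differentiable_hopfChart : Differentiable ℝ hopfChart := by
  have h1 : Differentiable ℝ fun z : ℂ × ℂ => Real.sqrt (1 + ‖z.2‖ ^ 2) := fun z =>
    ((differentiableAt_snd.norm_sq ℝ).const_add 1).sqrt (by positivity)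
  have h2 : Differentiable ℝ fun z : ℂ × ℂ => ofC z.1 * (1 + ofC z.2 * imUnit 0) :=
    (ofCL.differentiable.comp differentiable_fst).mul
      (((ofCL.differentiable.comp differentiable_snd).mul_const (imUnit 0)).const_add 1)
  exact fun z => ((h1 z).inv (by positivity)).smul (h2 z)

lemma fderiv_hopfChart (t : ℂ) (v : ℂ × ℂ) :
    fderiv ℝ hopfChart (t, 0) v = ofC v.1 + ofC t * (ofC v.2 * imUnit 0) := by
  have hline : HasDerivAt (fun s : ℝ => ((t, 0) : ℂ × ℂ) + s • v) v 0 := by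
    simpa using ((hasDerivAt_id (0 : ℝ)).smul_const v).const_add ((t, 0) : ℂ × ℂ)
  have h0 : HasFDerivAt hopfChart (fderiv ℝ hopfChart (t, 0)) ((t, 0) + (0 : ℝ) • v) := by
    simpa using (differentiable_hopfChart (t, 0)).hasFDerivAt
  refine (h0.comp_hasDerivAt (0 : ℝ) hline).unique ?_
  have h1 : HasDerivAt (fun s : ℝ => (Real.sqrt (1 + s ^ 2 * ‖v.2‖ ^ 2))⁻¹) 0 0 := by
    have a : HasDerivAt (fun s : ℝ => 1 + s ^ 2 * ‖v.2‖ ^ 2) 0 0 := by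
      simpa using (((hasDerivAt_id (0 : ℝ)).pow 2).mul_const (‖v.2‖ ^ 2)).const_add 1
    have b := (a.sqrt (by simp)).inv (by simp)
    exact b.congr_deriv (by simp)
  have h2 : HasDerivAt (fun s : ℝ => ofC t + s • ofC v.1) (ofC v.1) 0 := by
    simpa using ((hasDerivAt_id (0 : ℝ)).smul_const (ofC v.1)).const_add (ofC t)
  have h3 : HasDerivAt (fun s : ℝ => 1 + (s • ofC v.2) * imUnit 0) (ofC v.2 * imUnit 0) 0 := by
    simpa using (((hasDerivAt_id (0 : ℝ)).smul_const (ofC v.2)).mul_const (imUnit 0)).const_add 1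
  refine ((h1.smul (h2.mul h3)).congr_of_eventuallyEq
    (Eventually.of_forall fun s => ?_)).congr_deriv ?_
  · have e1 : ofC (t + s • v.1) = ofC t + s • ofC v.1 := by
      have := ofCL.map_add t (s • v.1); rwa [ofCL.map_smul] at this
    have e2 : ofC (s • v.2) = s • ofC v.2 := ofCL.map_smul s v.2
    have e3 : ((t, 0) : ℂ × ℂ) + s • v = (t + s • v.1, s • v.2) := Prod.ext rfl (zero_add _)
    simp only [Function.comp, e3, hopfChart, e1, e2, norm_smul, mul_pow, Real.norm_eq_abs, sq_abs]
    rfl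
  · simp

lemma differentiableAt_windMap (p : ℕ) {z : ℂ × ℂ} (hz : z.1 ≠ 0) :
    DifferentiableAt ℝ (windMap p) z := by
  have h1 : DifferentiableAt ℝ (fun z : ℂ × ℂ => ((‖z.1‖ : ℝ) : ℂ)) z :=
    Complex.ofRealCLM.differentiableAt.comp z (differentiableAt_fst.norm ℝ hz)
  have h2 : ((‖z.1‖ : ℝ) : ℂ) ≠ 0 := by simpa using hz
  have h3 : DifferentiableAt ℝ (fun z : ℂ × ℂ => z.1 / (‖z.1‖ : ℂ)) z :=
    differentiableAt_fst.mul (h1.inv h2)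
  have h4 : DifferentiableAt ℝ (fun z : ℂ × ℂ => (‖z.1‖ : ℂ) * (z.1 / (‖z.1‖ : ℂ)) ^ p) z :=
    h1.mul (h3.pow p)
  exact h4.prodMk differentiableAt_snd

lemma windMap_polar (p : ℕ) {ρ : ℝ} (hρ : 0 < ρ) {c : ℂ} (hc : ‖c‖ = 1) (u : ℂ) :
    windMap p (ρ * c, u) = (ρ * c ^ p, u) := by
  have h1 : ‖(ρ : ℂ) * c‖ = ρ := by simp [hc, abs_of_pos hρ]
  have h2 : (ρ : ℂ) ≠ 0 := by exact_mod_cast hρ.ne'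
  simp only [windMap, h1]
  rw [mul_div_cancel_left₀ _ h2]

lemma fderiv_windMap (p : ℕ) {ρ : ℝ} (hρ : 0 < ρ) {c : ℂ} (hc : ‖c‖ = 1) (α β : ℝ) (u : ℂ) :
    fderiv ℝ (windMap p) ((ρ : ℂ) * c, 0) ((α + β * Complex.I) * c, u)
      = ((α + β * (p * Complex.I)) * c ^ p, u) := by
  have hc0 : c ≠ 0 := by rintro rfl; simp at hc
  have hne : (ρ : ℂ) ≠ 0 := by exact_mod_cast hρ.ne'
  have hW := (differentiableAt_windMap p (z := ((ρ : ℂ) * c, 0)) (mul_ne_zero hne hc0)).hasFDerivAt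
  -- A curve in polar coordinates with the given velocity.
  set γ : ℝ → ℂ × ℂ := fun s =>
    (((ρ + s * α : ℝ) : ℂ) * (Complex.exp ((s * (β / ρ) : ℝ) * Complex.I) * c), s • u) with hγ
  have hexp : ∀ k : ℂ, HasDerivAt (fun s : ℝ => Complex.exp (k * ((s * (β / ρ) : ℝ) * Complex.I)))
      (k * ((β / ρ : ℝ) * Complex.I)) 0 := fun k => by
    have a : HasDerivAt (fun s : ℝ => ((s * (β / ρ) : ℝ) : ℂ)) ((β / ρ : ℝ) : ℂ) 0 := by
      simpa using ((hasDerivAt_id (0 : ℝ)).mul_const (β / ρ)).ofReal_comp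
    simpa using ((a.mul_const Complex.I).const_mul k).cexp
  have hrad : HasDerivAt (fun s : ℝ => ((ρ + s * α : ℝ) : ℂ)) α 0 := by
    simpa using (((hasDerivAt_id (0 : ℝ)).mul_const α).const_add ρ).ofReal_comp
  have hu : HasDerivAt (fun s : ℝ => s • u) u 0 := by
    simpa using (hasDerivAt_id (0 : ℝ)).smul_const u
  have hγd : HasDerivAt γ ((α + β * Complex.I) * c, u) 0 := by
    have a := hrad.mul (((hexp 1).mul_const c))
    simp only [one_mul] at a
    refine (HasDerivAt.congr_deriv a ?_).prodMk hu
    simp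
    field_simp
  have hγ0 : γ 0 = ((ρ : ℂ) * c, 0) := by simp [hγ]
  have hW' : HasFDerivAt (windMap p) (fderiv ℝ (windMap p) ((ρ : ℂ) * c, 0)) (γ 0) := by
    rw [hγ0]; exact hW
  refine (hW'.comp_hasDerivAt (0 : ℝ) hγd).unique ?_
  have h2 : HasDerivAt (fun s : ℝ => ((((ρ + s * α : ℝ) : ℂ)
      * (Complex.exp ((p : ℂ) * ((s * (β / ρ) : ℝ) * Complex.I)) * c ^ p), s • u) : ℂ × ℂ))
      ((α + β * (p * Complex.I)) * c ^ p, u) 0 := by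
    refine (HasDerivAt.congr_deriv (hrad.mul ((hexp p).mul_const (c ^ p))) ?_).prodMk hu
    simp
    field_simp
  refine h2.congr_of_eventuallyEq ?_
  have hpos : ∀ᶠ s : ℝ in 𝓝 0, 0 < ρ + s * α := by
    have : ContinuousAt (fun s : ℝ => ρ + s * α) 0 := by fun_prop
    exact this.eventually_const_lt (by simpa using hρ)
  filter_upwards [hpos] with s hs
  have hn : ‖Complex.exp ((s * (β / ρ) : ℝ) * Complex.I) * c‖ = 1 := by
    rw [norm_mul, Complex.norm_exp_ofReal_mul_I, hc, one_mul]
  rw [Function.comp, hγ, windMap_polar p hs hn, mul_pow, ← Complex.exp_nat_mul]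

/-- The metric near the bolt in the coordinates in which it extends smoothly, at the point
`(ρ c^p, 0)`, where `c` is a unit complex number. -/
lemma bolt_metric (hE : HasAdaptedCoframe R h J E) {p : ℕ} {H : BilinField (ℂ × ℂ)}
    (hH : ∀ z : ℂ × ℂ, z.1 ≠ 0 → ‖z.1‖ₑ < R → ∀ v w,
      H (windMap p z) (fderiv ℝ (windMap p) z v) (fderiv ℝ (windMap p) z w) =
        h (hopfChart z) (fderiv ℝ hopfChart z v) (fderiv ℝ hopfChart z w))
    {ρ : ℝ} (hρ : ρ ∈ radii R) {c : ℂ} (hc : ‖c‖ = 1) (α β α' β' : ℝ) (u u' : ℂ) :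
    H (ρ * c ^ p, 0) ((α + β * (p * Complex.I)) * c ^ p, u)
        ((α' + β' * (p * Complex.I)) * c ^ p, u') =
      α * α' + 4 * (![(c ^ 2 * u).re, (c ^ 2 * u).im, β / ρ] ⬝ᵥ
        (((E ρ)ᵀ * E ρ) *ᵥ ![(c ^ 2 * u').re, (c ^ 2 * u').im, β' / ρ])) := by
  have hc0 : c ≠ 0 := by rintro rfl; simp at hc
  have h0 := hρ.1
  have hne : (ρ : ℂ) ≠ 0 := by exact_mod_cast h0.ne'
  have hnorm : ‖(ρ : ℂ) * c‖ = ρ := by simp [hc, abs_of_pos h0]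
  have hx : ofC ((ρ : ℂ) * c) ∈ cylinder R := by
    rw [mem_cylinder_iff, norm_ofC, hnorm]; exact hρ
  have hcc : c.re ^ 2 + c.im ^ 2 = 1 := by
    rw [← Complex.sq_norm_sub_sq_im, hc]; ring
  have hen : ‖(ρ : ℂ) * c‖ₑ < R := by rw [← ofReal_norm, hnorm]; exact hρ.2
  have key := hH ((ρ : ℂ) * c, 0) (mul_ne_zero hne hc0) hen
    ((α + β * Complex.I) * c, u) ((α' + β' * Complex.I) * c, u')
  rw [fderiv_windMap p h0 hc, fderiv_windMap p h0 hc, windMap_polar p h0 hc, hopfChart_zero,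
    fderiv_hopfChart, fderiv_hopfChart] at key
  -- The tangent vectors of the chart, as multiples of the base point.
  have hmul : ∀ (a b : ℝ) (z : ℂ),
      ofC ((a + b * Complex.I) * c) + ofC (ρ * c) * (ofC z * imUnit 0)
      = (((a / ρ : ℝ) : ℍ[ℝ]) + imQ ![(c ^ 2 * z).re, (c ^ 2 * z).im, b / ρ]) * ofC (ρ * c) := by
    intro a b z
    have ha : a = a / ρ * ρ := (div_mul_cancel₀ a h0.ne').symm
    have hb : b = b / ρ * ρ := (div_mul_cancel₀ b h0.ne').symm
    generalize a / ρ = A at *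
    generalize b / ρ = B at *
    subst ha hb
    rw [show imUnit 0 = imQ ![1, 0, 0] from rfl]
    ext
    · simp
      ring
    · simp [pow_two]
      linear_combination (-ρ * (c.re * z.re - c.im * z.im)) * hcc
    · simp [pow_two]
      linear_combination (-ρ * (c.re * z.im + c.im * z.re)) * hcc
    · simp
      ring
  rw [hmul, hmul, metric_mul hE hx, norm_ofC, hnorm] at key
  rw [key]
  rw [vec_coe_add_imQ, vec_coe_add_imQ, re_coe_add_imQ, re_coe_add_imQ, ← Matrix.mulVec_mulVec,
    Matrix.dotProduct_mulVec, Matrix.vecMul_transpose]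
  have hsum : ∀ y z : Fin 3 → ℝ, ∑ i, (E ρ i ⬝ᵥ y) * (E ρ i ⬝ᵥ z) = (E ρ *ᵥ y) ⬝ᵥ (E ρ *ᵥ z) :=
    fun y z => rfl
  rw [hsum]
  field_simp

lemma dotProduct_mulVec3 (G : Matrix (Fin 3) (Fin 3) ℝ) (y z : Fin 3 → ℝ) :
    y ⬝ᵥ (G *ᵥ z) = y 0 * (G 0 0 * z 0 + G 0 1 * z 1 + G 0 2 * z 2)
      + y 1 * (G 1 0 * z 0 + G 1 1 * z 1 + G 1 2 * z 2)
      + y 2 * (G 2 0 * z 0 + G 2 1 * z 1 + G 2 2 * z 2) := by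
  simp only [dot3, Matrix.mulVec]

/-- A smooth extension to a bolt determines the leading terms of the metric. -/
lemma boltAsymptotics_of_smoothAtBolt (hR : 0 < R) (hE : HasAdaptedCoframe R h J E) {p : ℕ}
    (hp : 1 ≤ p) (hbolt : SmoothAtBolt R p h) :
    ∃ q, 0 < q ∧ BoltAsymptotics E q (p / 2) := by
  obtain ⟨H, hsm, hpos, hH⟩ := hbolt
  have hp0 : (0 : ℝ) < p := by exact_mod_cast hp
  have hdiff : DifferentiableAt ℝ H (0, 0) :=
    (hsm.contDiffAt ((isOpen_lt continuous_fst.enorm continuous_const).mem_nhds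
      (by simpa using hR))).differentiableAt (by simp)
  have hlin : ∀ (e : ℂ) (v w : ℂ × ℂ),
      (fun ρ : ℝ => H (ρ * e, 0) v w - H (0, 0) v w) =O[𝓝[>] 0] fun ρ => ρ := by
    intro e v w
    have h1 : DifferentiableAt ℝ (fun ρ : ℝ => ((ρ * e, 0) : ℂ × ℂ)) 0 :=
      (Complex.ofRealCLM.differentiableAt.mul_const e).prodMk (differentiableAt_const _)
    have h2 : DifferentiableAt ℝ (fun ρ : ℝ => H (ρ * e, 0)) 0 :=
      DifferentiableAt.comp (0 : ℝ) (g := H) (by simpa using hdiff) h1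
    have h3 := ((h2.clm_apply (differentiableAt_const v)).clm_apply
      (differentiableAt_const w)).isBigO_sub
    simpa using h3.mono nhdsWithin_le_nhds
  have hconst : ∀ {a b : ℝ} {f : ℝ → ℝ}, (fun ρ => f ρ - b) =O[𝓝[>] 0] (fun ρ : ℝ => ρ) →
      (∀ᶠ ρ in 𝓝[>] 0, f ρ = a) → b = a := by
    intro a b f h1 h2
    have h3 : Tendsto (fun ρ => f ρ - b) (𝓝[>] 0) (𝓝 0) :=
      h1.trans_tendsto (tendsto_id.mono_left nhdsWithin_le_nhds)
    have h4 : Tendsto (fun ρ => f ρ - b) (𝓝[>] 0) (𝓝 (a - b)) :=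
      tendsto_const_nhds.congr' (by filter_upwards [h2] with ρ hρ; rw [hρ])
    linarith [tendsto_nhds_unique h3 h4]
  have hrad := eventually_radii_nhdsGT hR
  -- A unit complex number `c` with `c^p = i`, and one with `c^2 = i`.
  obtain ⟨c, hcp⟩ := IsAlgClosed.exists_pow_nat_eq Complex.I (by omega : 0 < p)
  have hc : ‖c‖ = 1 := by
    have := congrArg norm hcp
    rw [norm_pow, Complex.norm_I] at this
    exact (pow_eq_one_iff_of_nonneg (norm_nonneg c) (by omega)).1 this
  obtain ⟨d, hd2⟩ := IsAlgClosed.exists_pow_nat_eq Complex.I (by omega : 0 < 2)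
  have hd : ‖d‖ = 1 := by
    have := congrArg norm hd2
    rw [norm_pow, Complex.norm_I] at this
    exact (pow_eq_one_iff_of_nonneg (norm_nonneg d) (by omega)).1 this
  have h1norm : ‖(1 : ℂ)‖ = 1 := norm_one
  -- At `(ρ i, 0)` the fibre direction `i` is radial, which gives the metric on the bolt in this
  -- direction.
  have hfib : H (0, 0) (Complex.I, 0) (Complex.I, 0) = 1 := by
    refine hconst (hlin Complex.I (Complex.I, 0) (Complex.I, 0)) ?_
    filter_upwards [hrad] with ρ hρ
    have := bolt_metric hE hH hρ hc 1 0 1 0 0 0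
    simpa [hcp] using this
  have hmix : ∀ u, H (0, 0) (Complex.I, 0) (0, u) = 0 := by
    intro u
    refine hconst (hlin Complex.I (Complex.I, 0) (0, u)) ?_
    filter_upwards [hrad] with ρ hρ
    have := bolt_metric hE hH hρ hc 1 0 0 0 0 u
    simpa [hcp] using this
  set q := H (0, 0) (0, 1) (0, 1) / 4 with hq
  -- The circle rotates the plane of `L₁, L₂`: the points over `1` and over `d ^ p` give the metric
  -- in two frames that differ by a quarter turn, but have the same limit at the bolt.
  have hb : ∀ u u', ∀ᶠ ρ : ℝ in 𝓝[>] 0, H (ρ * 1, 0) (0, u) (0, u')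
      = 4 * (![u.re, u.im, 0] ⬝ᵥ (((E ρ)ᵀ * E ρ) *ᵥ ![u'.re, u'.im, 0])) := by
    intro u u'
    filter_upwards [hrad] with ρ hρ
    simpa using bolt_metric hE hH hρ h1norm 0 0 0 0 u u'
  have hbd : ∀ u u', ∀ᶠ ρ : ℝ in 𝓝[>] 0, H (ρ * d ^ p, 0) (0, u) (0, u')
      = 4 * (![-u.im, u.re, 0] ⬝ᵥ (((E ρ)ᵀ * E ρ) *ᵥ ![-u'.im, u'.re, 0])) := by
    intro u u'
    filter_upwards [hrad] with ρ hρ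
    simpa [hd2] using bolt_metric hE hH hρ hd 0 0 0 0 u u'
  have hpc : (p : ℂ) ≠ 0 := by exact_mod_cast hp0.ne'
  have hcross : ∀ u, ∀ᶠ ρ : ℝ in 𝓝[>] 0, H (ρ * 1, 0) (Complex.I, 0) (0, u)
      = 4 * (![0, 0, (p : ℝ)⁻¹ / ρ] ⬝ᵥ (((E ρ)ᵀ * E ρ) *ᵥ ![u.re, u.im, 0])) := by
    intro u
    filter_upwards [hrad] with ρ hρ
    simpa [hpc] using bolt_metric hE hH hρ h1norm 0 (p : ℝ)⁻¹ 0 0 0 u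
  have hfibre : ∀ᶠ ρ : ℝ in 𝓝[>] 0, H (ρ * 1, 0) (Complex.I, 0) (Complex.I, 0)
      = 4 * (![0, 0, (p : ℝ)⁻¹ / ρ] ⬝ᵥ (((E ρ)ᵀ * E ρ) *ᵥ ![0, 0, (p : ℝ)⁻¹ / ρ])) := by
    filter_upwards [hrad] with ρ hρ
    simpa [hpc] using bolt_metric hE hH hρ h1norm 0 (p : ℝ)⁻¹ 0 (p : ℝ)⁻¹ 0 0
  have hs : ∀ ρ i j, ((E ρ)ᵀ * E ρ) i j = ((E ρ)ᵀ * E ρ) j i := fun ρ => gram_symm (E ρ)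
  simp only [dotProduct_mulVec3] at hb hbd hcross hfibre
  have hid := isBigO_refl (fun ρ : ℝ => ρ) (𝓝[>] 0)
  refine ⟨q, div_pos (hpos 0 (0, 1) (by simp)) (by norm_num), ?_, ?_, ?_, ?_, ?_, ?_⟩
  · refine ((hlin 1 (0, 1) (0, 1)).const_mul_left (1 / 4)).congr' ?_ EventuallyEq.rfl
    filter_upwards [hb 1 1] with ρ hρ
    rw [hρ, hq]
    simp
    ring
  · refine ((hlin (d ^ p) (0, 1) (0, 1)).const_mul_left (1 / 4)).congr' ?_ EventuallyEq.rfl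
    filter_upwards [hbd 1 1] with ρ hρ
    rw [hρ, hq]
    simp
    ring
  · refine (((hlin 1 (0, 1) (0, Complex.I)).sub
      (hlin (d ^ p) (0, 1) (0, Complex.I))).const_mul_left (1 / 8)).congr' ?_ EventuallyEq.rfl
    filter_upwards [hb 1 Complex.I, hbd 1 Complex.I] with ρ hρ hρ'
    rw [hρ, hρ', hs ρ 1 0]
    simp
    ring
  -- At `(ρ, 0)` the fibre direction `i` is tangent to the circle; as a multiple of `L₃` it has a
  -- factor `1 / ρ`, so that the coefficients of the metric gain a factor `ρ` for every index `2`.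
  · refine (((hid.mul (hlin 1 (Complex.I, 0) (0, 1))).const_mul_left (p / 4)).congr' ?_
      EventuallyEq.rfl).trans (IsBigO.of_norm_le fun ρ => (by simp [pow_two]))
    filter_upwards [hcross 1, hrad] with ρ hρ hmem
    have h0 := hmem.1.ne'
    rw [hρ, hmix, hs ρ 0 2]
    simp
    field_simp
  · refine (((hid.mul (hlin 1 (Complex.I, 0) (0, Complex.I))).const_mul_left (p / 4)).congr' ?_
      EventuallyEq.rfl).trans (IsBigO.of_norm_le fun ρ => (by simp [pow_two]))
    filter_upwards [hcross Complex.I, hrad] with ρ hρ hmem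
    have h0 := hmem.1.ne'
    rw [hρ, hmix, hs ρ 1 2]
    simp
    field_simp
  · refine ((((hid.mul hid).mul (hlin 1 (Complex.I, 0) (Complex.I, 0))).const_mul_left
      ((p : ℝ) ^ 2 / 4)).congr' ?_ EventuallyEq.rfl).trans
      (isBigO_of_le _ fun ρ => (by simp [pow_succ]))
    filter_upwards [hfibre, hrad] with ρ hρ hmem
    have h0 := hmem.1.ne'
    rw [hρ, hfib]
    simp
    field_simp
    ring

/-- That the bolt is complex means that the first two components of `E₂` tend to zero. -/
lemma slowAtZero_of_boltI (hR : 0 < R) (hK : IsKahlerOn (cylinder R) h J)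
    (hE : HasAdaptedCoframe R h J E) (hbolt : SmoothAtBoltI R h J) : SlowAtZero E := by
  obtain ⟨⟨p, hp, hsm⟩, hcomplex⟩ := hbolt
  obtain ⟨q, hq, hB⟩ := boltAsymptotics_of_smoothAtBolt hR hE hp hsm
  have hp0 : (1 : ℝ) ≤ p := by exact_mod_cast hp
  have hv : ∀ i : Fin 3, i ≠ 2 → Tendsto (fun ρ => E ρ 2 i) (𝓝[>] 0) (𝓝 0) := by
    intro i hi
    refine (hcomplex 1 norm_one i hi).congr' ?_
    filter_upwards [eventually_radii_nhdsGT hR] with ρ hρ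
    have h0 := hρ.1.ne'
    have e1 : ρ • (1 : ℍ[ℝ]) = (ρ : ℍ[ℝ]) := by rw [← Quaternion.coe_mul_eq_smul, mul_one]
    have e2 : imUnit i = imQ (Pi.single i 1) := by
      fin_cases i <;> ext <;> simp [imUnit]
    have e3 : leftGen i (ρ : ℍ[ℝ]) = imQ ((-(ρ / 2)) • Pi.single i 1) := by
      rw [leftGen, e2, ← Quaternion.coe_commutes, Quaternion.coe_mul_eq_smul, smul_smul]
      rw [show -(1 / 2) * ρ = -(ρ / 2) by ring]
      ext <;> simp
    have e4 : vec (1 : ℍ[ℝ]) = 0 := by apply vec3_ext <;> simp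
    rw [e1, e3, form_real hE hρ, vec_imQ, e4, re_imQ, Quaternion.re_one, dotProduct_smul,
      dotProduct_single]
    simp
    field_simp
  refine slowAtZero_of_boltAsymptotics hR hK hE hq (by linarith : (0 : ℝ) < p / 2) ?_ hB
    (hv 0 (by decide)) (hv 1 (by decide))
  rcases hp.eq_or_lt with rfl | h2
  · right; norm_num
  · left
    have : (2 : ℝ) ≤ p := by exact_mod_cast h2
    exact inv_le_one_of_one_le₀ (by linarith)

end SU2Kahler

end

theorem mainTheorem5 (R : ENNReal) (hR : 0 < R)
    (h : BilinField (Quaternion ℝ)) (J : EndField (Quaternion ℝ))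
    (hK : IsKahlerOn (cylinder R) h J) (hinv : IsSU2Invariant (cylinder R) h J)
    (E : ℝ → Matrix (Fin 3) (Fin 3) ℝ) (hE : HasAdaptedCoframe R h J E)
    (hsmooth : SmoothAtNut R h ∨ SmoothAtBoltI R h J) :
    HasU1SU2Symmetry R h J ∧
      ∀ a b c b₁ c₁ c₂ : ℝ → ℝ,
        (∀ ρ ∈ radii R, 0 < a ρ ∧ 0 < b ρ ∧ 0 < c ρ ∧
          E ρ = !![a ρ, b₁ ρ, c₁ ρ; 0, b ρ, c₂ ρ; 0, 0, c ρ]) →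
        ∀ ρ ∈ radii R, a ρ = b ρ ∧ b₁ ρ = 0 ∧ c₁ ρ = 0 ∧ c₂ ρ = 0 := by
  have hslow : SlowAtZero E :=
    hsmooth.elim (slowAtZero_of_nut hR hE) (slowAtZero_of_boltI hR hK hE)
  have hround : ∀ ρ ∈ radii R, roundness (E ρ) = 1 ∧ tilt (E ρ) = 0 := fun ρ hρ =>
    ⟨roundness_eq_one hK hinv hE hslow hρ, tilt_eq_zero hK hinv hE hslow hρ⟩
  refine ⟨hasU1SU2Symmetry_of_round hR hK hinv hE hround, fun a b c b₁ c₁ c₂ htri ρ hρ => ?_⟩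
  obtain ⟨ha, hb, hc, hM⟩ := htri ρ hρ
  exact triangular_of_round (hE.oriented ρ hρ) (hround ρ hρ).1 (hround ρ hρ).2 ha hb hc hM
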